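/- For a nondegenerate closed triangle $\Delta\subset\mathbb R^2$ with vertex set $\{A,B,C\}$, edge lengths $a,b,c$ and circumradius $R$, define its Voronoi functional by $$V(\Delta)=\int_{\Delta}\min_{v\in\{A,B,C\}}\|x-v\|^2\,dx\ \text{ if }\Delta\text{ is acute},\qquad V(\Delta)=\tfrac{\mathrm{area}(\Delta)}{12}\,(a^2+b^2+c^2-4R^2)\ \text{ otherwise}.$$ A vertex $v$ of $\Delta$ is visible from $x\in\mathbb R^2$ if the segment from $x$ to $v$ meets $\Delta$ only in $v$. Let $g_\Delta(x)$ be the squared distance from $x$ to the nearest vertex of $\Delta$ minus the squared distance from $x$ to the nearest visible vertex of $\Delta$, where the second term is $0$ if no vertex is visible. For a finite family $T$ of triangles put $V(T)=\sum_{\Delta\in T}V(\Delta)$ and $g_T(x)=\sum_{\Delta\in T}g_\Delta(x)$; for a simplicial complex the sums range over its triangles. Voronoi Optimality Theorem. Let $S\subset\mathbb R^2$ be a finite set in general position, meaning that no four points of $S$ lie on a common circle. Let $D$ be the Delaunay triangulation of $S$, consisting of all nondegenerate triangles spanned by three points of $S$ whose circumcircle encloses no point of $S$. Let $K$ be a geometric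 triangulation of $S$, that is, a simplicial complex in $\mathbb R^2$ with vertex set $S$ and underlying space $\mathrm{conv}(S)$. Then $$V(K)\le V(D).$$ Moreover, $g_K(x)\le g_D(x)$ for every $x\in\mathbb R^2$ that is a point of $S$ or lies in at most one closed triangle of $K$ (that is, for every $x$ outside the relative interiors of the edges shared by two triangles of $K$). -/

import Mathlib

open MeasureTheory

noncomputable section

namespace VoronoiFunctional

/-- The Euclidean plane. -/
abbrev Plane : Type := EuclideanSpace ℝ (Fin 2)

/-! Triangles are represented by the finite sets of their three vertices; the closed triangle is the
convex hull of that set. -/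

/-- All interior angles of the triangle with vertex set `Δ` are smaller than `π / 2`. -/
def IsAcute (Δ : Finset Plane) : Prop :=
  ∀ p ∈ Δ, ∀ q ∈ Δ, ∀ r ∈ Δ, p ≠ q → q ≠ r → p ≠ r → EuclideanGeometry.angle p q r < Real.pi / 2

/-- The area of the triangle with vertex set `Δ`. -/
def area (Δ : Finset Plane) : ℝ := volume.real (convexHull ℝ (Δ : Set Plane))

/-- The sum of the squared edge lengths (each edge appears twice in the double sum). -/
def sumSqEdges (Δ : Finset Plane) : ℝ := (∑ p ∈ Δ, ∑ q ∈ Δ, dist p q ^ 2) / 2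

/-- The circumradius: the radius of the smallest circle that passes through all the vertices. -/
def circumradius (Δ : Finset Plane) : ℝ :=
  sInf {r : ℝ | ∃ c : Plane, ∀ v ∈ Δ, dist v c = r}

open Classical in
/-- The Voronoi functional of a triangle. For an acute triangle it is the integral, over the
triangle, of the squared distance to the nearest vertex; for a non-acute triangle it is
`area / 12 * (a ^ 2 + b ^ 2 + c ^ 2 - 4 * R ^ 2)`. -/
def triangleVoronoi (Δ : Finset Plane) : ℝ :=
  if IsAcute Δ then
    ∫ x in convexHull ℝ (Δ : Set Plane), Metric.infDist x (Δ : Set Plane) ^ 2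
  else
    area Δ / 12 * (sumSqEdges Δ - 4 * circumradius Δ ^ 2)

/-- The Voronoi functional of a finite family of triangles. -/
def voronoi (T : Finset (Finset Plane)) : ℝ := ∑ Δ ∈ T, triangleVoronoi Δ

/-- The vertices of `Δ` visible from `x`: the segment from `x` to the vertex meets the closed
triangle only in this vertex. -/
def visibleVertices (Δ : Finset Plane) (x : Plane) : Set Plane :=
  {v | v ∈ Δ ∧ segment ℝ x v ∩ convexHull ℝ (Δ : Set Plane) = {v}}

/-- The local Voronoi functional of a triangle: the squared distance from `x` to the nearest vertex
minus the squared distance from `x` to the nearest visible vertex. If no vertex is visible, the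
second term is `0`, which is the value of `Metric.infDist x ∅`. -/
def localTriangle (Δ : Finset Plane) (x : Plane) : ℝ :=
  Metric.infDist x (Δ : Set Plane) ^ 2 - Metric.infDist x (visibleVertices Δ x) ^ 2

/-- The local Voronoi functional of a finite family of triangles. -/
def localVoronoi (T : Finset (Finset Plane)) (x : Plane) : ℝ := ∑ Δ ∈ T, localTriangle Δ x

/-- General position: no four points of `S` lie on a common circle. -/
def GeneralPosition (S : Finset Plane) : Prop :=
  ∀ Q ⊆ S, Q.card = 4 → ¬ EuclideanGeometry.Cospherical (Q : Set Plane)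

/-- No point of `S` is enclosed by the circle through the vertices of `Δ`. -/
def EmptyCircumcircle (S Δ : Finset Plane) : Prop :=
  ∃ (c : Plane) (r : ℝ), (∀ v ∈ Δ, dist v c = r) ∧ ∀ p ∈ S, r ≤ dist p c

open Classical in
/-- The Delaunay triangulation, as the family of its triangles: all (non-degenerate) triangles
spanned by three points of `S` whose circumcircle encloses no point of `S`. -/
def delaunay (S : Finset Plane) : Finset (Finset Plane) :=
  {Δ ∈ S.powersetCard 3 |
    AffineIndependent ℝ ((↑) : Δ → Plane) ∧ EmptyCircumcircle S Δ}

/-- `K` is a geometric triangulation of `S`: a simplicial complex in the plane with vertex set `S`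
whose underlying space is the convex hull of `S`. -/
structure IsGeometricTriangulation (S : Finset Plane) (K : Geometry.SimplicialComplex ℝ Plane) :
    Prop where
  vertices_eq : K.vertices = (S : Set Plane)
  space_eq : K.space = convexHull ℝ (S : Set Plane)

open Classical in
/-- The triangles of a simplicial complex `K` with vertex set `S`. -/
def triangles (S : Finset Plane) (K : Geometry.SimplicialComplex ℝ Plane) :
    Finset (Finset Plane) :=
  {Δ ∈ S.powersetCard 3 | Δ ∈ K.faces}

end VoronoiFunctional

end

open MeasureTheory

noncomputable section

namespace VoronoiFunctional

/-! The functional of a triangle is the integral of its local functional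
(`IsTriangle.integral_local`), so the inequality between the two triangulations follows from the
pointwise one, which may fail only on a null set, the edges of `K`.

For the pointwise inequality, fix `x` and a triangle `Δ` not containing `x`. Then `-localTriangle Δ
x` is the length of the interval of all `t` between the squared distances to the nearest vertex and
to the nearest visible vertex. A level `t = ρ ^ 2` belongs to it exactly when one vertex within `ρ`
is hidden behind the opposite edge and both ends of that edge are farther than `ρ`; this is the
predicate `Hidden`. A triangle containing `x` contributes the squared distance to its nearest
vertex. Comparing local functionals thus becomes comparing unions of intervals (`sum_length_le`),
one level at a time.

Emptiness of circumcircles enters through differences of powers of a point, which are affine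
functions. They show that at a given level at most one Delaunay triangle has a hidden vertex
(`Hidden.unique`), and that a Delaunay triangle containing `x` then has no vertex within `ρ`
(`Hidden.lt_dist_of_mem_hull`). For `K`, one follows a segment from `x` to a close point of `S` and
finds an edge that hides a close vertex (`exists_hidden_of_far`, `exists_hidden_of_delaunay`).

If `x` is outside the convex hull of `S`, the Delaunay intervals are disjoint and covered by those
of `K`. If `x` is inside, the squared distance from `x` to `S` separates the two values: the
intervals of `K` cover the gap between this number and the term of the triangle containing `x`,
while the Delaunay intervals are disjoint and fit into the corresponding gap.

For the integral of the local functional, nothing outside an acute triangle contributes. For other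
triangles only the vertex with the non-acute angle can be a hidden nearest vertex, and the integral
splits into explicit integrals over triangles (`integral_model`). -/

/-- `Δ` is the vertex set of a nondegenerate triangle. -/
def IsTriangle (Δ : Finset Plane) : Prop :=
  Δ.card = 3 ∧ AffineIndependent ℝ ((↑) : Δ → Plane)

/-! ### Barycentric coordinates -/

/-- `a`, `b`, `c` are the barycentric coordinates of the triangle with vertices `p`, `q`, `r`. -/
structure Bary (p q r : Plane) (a b c : Plane →ᵃ[ℝ] ℝ) : Prop where
  ap : a p = 1
  aq : a q = 0
  ar : a r = 0
  bp : b p = 0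
  bq : b q = 1
  br : b r = 0
  cp : c p = 0
  cq : c q = 0
  cr : c r = 1
  sum : ∀ y, a y + b y + c y = 1
  comb : ∀ y, a y • p + b y • q + c y • r = y

namespace Bary

variable {p q r : Plane} {a b c : Plane →ᵃ[ℝ] ℝ}

theorem swap (h : Bary p q r a b c) : Bary q p r b a c :=
  ⟨h.bq, h.bp, h.br, h.aq, h.ap, h.ar, h.cq, h.cp, h.cr,
    fun y => by linarith [h.sum y], fun y => by
      conv_rhs => rw [← h.comb y]
      abel⟩

theorem rotate (h : Bary p q r a b c) : Bary q r p b c a :=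
  ⟨h.bq, h.br, h.bp, h.cq, h.cr, h.cp, h.aq, h.ar, h.ap,
    fun y => by linarith [h.sum y], fun y => by
      conv_rhs => rw [← h.comb y]
      abel⟩

end Bary

theorem affine_comb₂ (l : Plane →ᵃ[ℝ] ℝ) (x y : Plane) (s t : ℝ) (h : s + t = 1) :
    l (s • x + t • y) = s * l x + t * l y := by
  have := Convex.combo_affine_apply (f := l) (x := x) (y := y) h
  simpa using this

theorem affine_comb₃ (l : Plane →ᵃ[ℝ] ℝ) (x y z : Plane) (s t u : ℝ) (h : s + t + u = 1) :
    l (s • x + t • y + u • z) = s * l x + t * l y + u * l z := by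
  have e : ∀ w, l w = l.linear w + l 0 := fun w => congrFun (AffineMap.decomp l) w
  rw [e (s • x + t • y + u • z), e x, e y, e z]
  simp only [map_add, map_smul, smul_eq_mul]
  linear_combination (-(l 0)) * h

namespace Bary

variable {p q r : Plane} {a b c : Plane →ᵃ[ℝ] ℝ}

theorem apply_eq (h : Bary p q r a b c) (l : Plane →ᵃ[ℝ] ℝ) (y : Plane) :
    l y = a y * l p + b y * l q + c y * l r := by
  conv_lhs => rw [← h.comb y]
  exact affine_comb₃ l p q r _ _ _ (h.sum y)

theorem mem_hull_iff (h : Bary p q r a b c) {Δ : Finset Plane} (hΔ : (Δ : Set Plane) = {p, q, r})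
    (y : Plane) :
    y ∈ convexHull ℝ (Δ : Set Plane) ↔ 0 ≤ a y ∧ 0 ≤ b y ∧ 0 ≤ c y := by
  rw [hΔ]
  constructor
  · intro hy
    have key : ∀ l : Plane →ᵃ[ℝ] ℝ, 0 ≤ l p → 0 ≤ l q → 0 ≤ l r → 0 ≤ l y := by
      intro l h1 h2 h3
      have hc : Convex ℝ {z | 0 ≤ l z} := by
        have := (convex_Ici (0 : ℝ)).affine_preimage l
        exact this
      have : convexHull ℝ {p, q, r} ⊆ {z | 0 ≤ l z} := by
        apply convexHull_min _ hc
        rintro z (rfl | rfl | rfl) <;> assumption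
      exact this hy
    refine ⟨key a ?_ ?_ ?_, key b ?_ ?_ ?_, key c ?_ ?_ ?_⟩ <;>
      simp [h.ap, h.aq, h.ar, h.bp, h.bq, h.br, h.cp, h.cq, h.cr]
  · rintro ⟨ha, hb, hc⟩
    have hs := convex_convexHull ℝ ({p, q, r} : Set Plane)
    rw [← h.comb y]
    have := hs.sum_mem (t := (Finset.univ : Finset (Fin 3))) (w := ![a y, b y, c y])
      (z := ![p, q, r]) ?_ ?_ ?_
    · simpa [Fin.sum_univ_three] using this
    · intro i _
      fin_cases i <;> simpa
    · simpa [Fin.sum_univ_three] using h.sum y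
    · intro i _
      apply subset_convexHull
      fin_cases i <;> simp

theorem mem_segment_iff (h : Bary p q r a b c) (y : Plane) :
    y ∈ convexHull ℝ {p, q} ↔ 0 ≤ a y ∧ 0 ≤ b y ∧ c y = 0 := by
  rw [convexHull_pair]
  constructor
  · rintro ⟨s, t, hs, ht, hst, rfl⟩
    simp only [affine_comb₂ _ _ _ _ _ hst, h.ap, h.aq, h.bp, h.bq, h.cp, h.cq]
    simp [hs, ht]
  · rintro ⟨ha, hb, hc⟩
    refine ⟨a y, b y, ha, hb, by linarith [h.sum y], ?_⟩
    have := h.comb y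
    simpa [hc] using this

end Bary

theorem IsTriangle.exists_bary {Δ : Finset Plane} (h : IsTriangle Δ) {r : Plane} (hr : r ∈ Δ) :
    ∃ p q a b c, Bary p q r a b c ∧ (Δ : Set Plane) = {p, q, r} := by
  classical
  obtain ⟨h3, hA⟩ := h
  have hcard : (Δ.erase r).card = 2 := by rw [Finset.card_erase_of_mem hr, h3]
  obtain ⟨p, q, hpq, he⟩ := Finset.card_eq_two.1 hcard
  have hp' : p ∈ Δ.erase r := by simp [he]
  have hq' : q ∈ Δ.erase r := by simp [he]
  obtain ⟨hpr, hp⟩ := Finset.mem_erase.1 hp'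
  obtain ⟨hqr, hq⟩ := Finset.mem_erase.1 hq'
  have hΔ : Δ = {p, q, r} := by
    rw [← Finset.insert_erase hr, he]
    ext; simp; tauto
  have hspan : affineSpan ℝ (Set.range ((↑) : Δ → Plane)) = ⊤ := by
    rw [hA.affineSpan_eq_top_iff_card_eq_finrank_add_one]
    simp [h3]
  let B : AffineBasis Δ ℝ Plane := ⟨(↑), hA, hspan⟩
  have hB : ∀ v : Δ, B v = v := fun v => rfl
  have hz : ∀ i j : Δ, B.coord i j = if i = j then 1 else 0 := by
    intro i j
    rw [← hB j, AffineBasis.coord_apply]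
  have hsum : ∀ F : Δ → ℝ, ∑ i, F i = F ⟨p, hp⟩ + F ⟨q, hq⟩ + F ⟨r, hr⟩ := by
    intro F
    have : (Finset.univ : Finset Δ) = {⟨p, hp⟩, ⟨q, hq⟩, ⟨r, hr⟩} := by
      ext ⟨v, hv⟩
      have : v ∈ ({p, q, r} : Finset Plane) := hΔ ▸ hv
      simpa using this
    rw [this, Finset.sum_insert, Finset.sum_insert, Finset.sum_singleton, add_assoc]
    · simpa using hqr
    · simp [hpq, hpr]
  have hsum' : ∀ F : Δ → Plane, ∑ i, F i = F ⟨p, hp⟩ + F ⟨q, hq⟩ + F ⟨r, hr⟩ := by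
    intro F
    have : (Finset.univ : Finset Δ) = {⟨p, hp⟩, ⟨q, hq⟩, ⟨r, hr⟩} := by
      ext ⟨v, hv⟩
      have : v ∈ ({p, q, r} : Finset Plane) := hΔ ▸ hv
      simpa using this
    rw [this, Finset.sum_insert, Finset.sum_insert, Finset.sum_singleton, add_assoc]
    · simpa using hqr
    · simp [hpq, hpr]
  refine ⟨p, q, B.coord ⟨p, hp⟩, B.coord ⟨q, hq⟩, B.coord ⟨r, hr⟩, ?_, by simp [hΔ]⟩
  constructor
  · simpa using hz ⟨p, hp⟩ ⟨p, hp⟩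
  · simpa [hpq] using hz ⟨p, hp⟩ ⟨q, hq⟩
  · simpa [hpr] using hz ⟨p, hp⟩ ⟨r, hr⟩
  · simpa [hpq.symm] using hz ⟨q, hq⟩ ⟨p, hp⟩
  · simpa using hz ⟨q, hq⟩ ⟨q, hq⟩
  · simpa [hqr] using hz ⟨q, hq⟩ ⟨r, hr⟩
  · simpa [hpr.symm] using hz ⟨r, hr⟩ ⟨p, hp⟩
  · simpa [hqr.symm] using hz ⟨r, hr⟩ ⟨q, hq⟩
  · simpa using hz ⟨r, hr⟩ ⟨r, hr⟩
  · intro y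
    have := B.sum_coord_apply_eq_one y
    rwa [hsum] at this
  · intro y
    have := B.linear_combination_coord_eq_self y
    rwa [hsum'] at this

/-- The difference of two squared distance functions, as an affine map. -/
def powDiff (o o' : Plane) : Plane →ᵃ[ℝ] ℝ :=
  ((innerₛₗ ℝ ((2 : ℝ) • (o' - o)))).toAffineMap +
    AffineMap.const ℝ Plane (‖o‖ ^ 2 - ‖o'‖ ^ 2)

theorem powDiff_apply (o o' y : Plane) : powDiff o o' y = dist y o ^ 2 - dist y o' ^ 2 := by
  simp only [powDiff, dist_eq_norm, norm_sub_sq_real]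
  simp [real_inner_comm]
  ring

theorem Bary.vertices_ne {p q r : Plane} {a b c : Plane →ᵃ[ℝ] ℝ} (h : Bary p q r a b c) :
    p ≠ q ∧ q ≠ r ∧ p ≠ r := by
  refine ⟨?_, ?_, ?_⟩ <;> rintro rfl
  · linarith [h.ap, h.aq]
  · linarith [h.bq, h.br]
  · linarith [h.ap, h.ar]

/-! ### Visible and hidden vertices -/

namespace Bary

variable {p q r : Plane} {a b c : Plane →ᵃ[ℝ] ℝ} {Δ : Finset Plane}

theorem set_swap (hΔ : (Δ : Set Plane) = {p, q, r}) : (Δ : Set Plane) = {q, p, r} := by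
  rw [hΔ, Set.insert_comm]

theorem set_rotate (hΔ : (Δ : Set Plane) = {p, q, r}) : (Δ : Set Plane) = {q, r, p} := by
  rw [hΔ, Set.insert_comm, Set.pair_comm p r]

/-- Near `r` the triangle coincides with the cone `0 ≤ a`, `0 ≤ b` with apex `r`, so the segment
from `x` to `r` runs into the triangle before `r` exactly when `x` lies in this cone and is not the
apex. -/
theorem mem_visible_iff (h : Bary p q r a b c) (hΔ : (Δ : Set Plane) = {p, q, r}) (x : Plane) :
    r ∈ visibleVertices Δ x ↔ x = r ∨ a x < 0 ∨ b x < 0 := by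
  have hr : r ∈ Δ := by
    rw [← Finset.mem_coe, hΔ]; simp
  have hrh : r ∈ convexHull ℝ (Δ : Set Plane) := subset_convexHull ℝ _ hr
  constructor
  · rintro ⟨-, hv⟩
    by_contra! hcon
    obtain ⟨hxr, ha, hb⟩ := hcon
    -- Shrinking towards `r` by the factor `1 / (1 + k)` keeps `a` and `b` nonnegative and turns `c
    -- x` into `(c x + k) / (1 + k)`, which is nonnegative for this `k`.
    set k := |c x| with hk
    have hk0 : 0 ≤ k := abs_nonneg _
    have hne : (1 + k) ≠ 0 := by positivity
    have hst : (1 + k)⁻¹ + k * (1 + k)⁻¹ = 1 := by field_simp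
    set y := (1 + k)⁻¹ • x + (k * (1 + k)⁻¹) • r with hy
    have hyseg : y ∈ segment ℝ x r := ⟨_, _, by positivity, by positivity, hst, rfl⟩
    have hyh : y ∈ convexHull ℝ (Δ : Set Plane) := by
      rw [h.mem_hull_iff hΔ]
      simp only [hy, affine_comb₂ _ _ _ _ _ hst, h.ar, h.br, h.cr]
      refine ⟨by simp; positivity, by simp; positivity, ?_⟩
      have : 0 ≤ (1 + k)⁻¹ * (c x + k) :=
        mul_nonneg (by positivity) (by linarith [neg_abs_le (c x)])
      linarith
    have hyr : y = r := by
      have : y ∈ segment ℝ x r ∩ convexHull ℝ (Δ : Set Plane) := ⟨hyseg, hyh⟩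
      rw [hv] at this
      exact this
    apply hxr
    have h1 : (1 + k)⁻¹ • x = (1 + k)⁻¹ • r := by
      have h2 : (k * (1 + k)⁻¹) = 1 - (1 + k)⁻¹ := by linarith
      rw [hy, h2, sub_smul, one_smul] at hyr
      have h3 : (1 + k)⁻¹ • x = ((1 + k)⁻¹ • x + (r - (1 + k)⁻¹ • r)) - r + (1 + k)⁻¹ • r := by
        abel
      rw [h3, hyr]
      abel
    exact smul_right_injective Plane (inv_ne_zero hne) h1
  · rintro hx
    refine ⟨hr, ?_⟩
    rcases hx with rfl | hx
    · rw [segment_same]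
      exact Set.inter_eq_left.2 (by simpa using hrh)
    · apply Set.Subset.antisymm
      · rintro y ⟨⟨s, t, hs, ht, hst, rfl⟩, hyh⟩
        rw [h.mem_hull_iff hΔ] at hyh
        simp only [affine_comb₂ _ _ _ _ _ hst, h.ar, h.br, h.cr] at hyh
        have hs0 : s = 0 := by
          by_contra hne
          have hs' : 0 < s := lt_of_le_of_ne hs (Ne.symm hne)
          rcases hx with hx | hx
          · nlinarith [mul_neg_of_pos_of_neg hs' hx]
          · nlinarith [mul_neg_of_pos_of_neg hs' hx]
        have : t = 1 := by linarith
        simp [hs0, this]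
      · rintro _ rfl
        exact ⟨right_mem_segment ℝ _ _, hrh⟩

theorem visible_eq_of_hidden (h : Bary p q r a b c) (hΔ : (Δ : Set Plane) = {p, q, r}) {x : Plane}
    (ha : 0 ≤ a x) (hb : 0 ≤ b x) (hc : c x < 0) : visibleVertices Δ x = {p, q} := by
  have h1 := (h.rotate.mem_visible_iff (set_rotate hΔ) x)
  have h2 := (h.rotate.rotate.mem_visible_iff (set_rotate (set_rotate hΔ)) x)
  have h3 := (h.mem_visible_iff hΔ x)
  have hx : x ≠ r := by
    rintro rfl
    linarith [h.cr]
  have hp : p ∈ visibleVertices Δ x := h1.2 (Or.inr (Or.inr hc))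
  have hq : q ∈ visibleVertices Δ x := h2.2 (Or.inr (Or.inl hc))
  have hr : r ∉ visibleVertices Δ x := by
    rw [h3]; rintro (h' | h' | h')
    · exact hx h'
    · linarith
    · linarith
  ext v
  constructor
  · intro hv
    have : v ∈ (Δ : Set Plane) := hv.1
    rw [hΔ] at this
    rcases this with rfl | rfl | rfl
    · simp
    · simp
    · exact absurd hv hr
  · rintro (rfl | rfl) <;> assumption

theorem visible_eq_of_two_neg (h : Bary p q r a b c) (hΔ : (Δ : Set Plane) = {p, q, r}) {x : Plane}
    (ha : a x < 0) (hb : b x < 0) : visibleVertices Δ x = Δ := by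
  have h1 := (h.rotate.mem_visible_iff (set_rotate hΔ) x)
  have h2 := (h.rotate.rotate.mem_visible_iff (set_rotate (set_rotate hΔ)) x)
  have h3 := (h.mem_visible_iff hΔ x)
  apply Set.Subset.antisymm
  · exact fun v hv => hv.1
  · rw [hΔ]
    rintro v (rfl | rfl | rfl)
    · exact h1.2 (Or.inr (Or.inl hb))
    · exact h2.2 (Or.inr (Or.inr ha))
    · exact h3.2 (Or.inr (Or.inl ha))

end Bary

theorem infDist_le_iff {Δ : Finset Plane} (hΔ : Δ.Nonempty) (x : Plane) (ρ : ℝ) :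
    Metric.infDist x (Δ : Set Plane) ≤ ρ ↔ ∃ v ∈ Δ, dist v x ≤ ρ := by
  constructor
  · intro h
    obtain ⟨v, hv, he⟩ := Δ.finite_toSet.isCompact.exists_infDist_eq_dist hΔ x
    exact ⟨v, hv, by rw [dist_comm, ← he]; exact h⟩
  · rintro ⟨v, hv, h⟩
    rw [dist_comm] at h
    exact (Metric.infDist_le_dist_of_mem (Finset.mem_coe.2 hv)).trans h

theorem infDist_pair (x p q : Plane) :
    Metric.infDist x {p, q} = min (dist p x) (dist q x) := by
  classical
  have hne : ({p, q} : Finset Plane).Nonempty := by simp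
  have h := infDist_le_iff hne x
  have hc : ((({p, q} : Finset Plane)) : Set Plane) = {p, q} := by simp
  rw [hc] at h
  apply le_antisymm
  · rw [h]
    rcases min_choice (dist p x) (dist q x) with h' | h' <;> rw [h'] <;> simp
  · obtain ⟨v, hv, hd⟩ := (h _).1 le_rfl
    simp only [Finset.mem_insert, Finset.mem_singleton] at hv
    rcases hv with rfl | rfl
    · exact (min_le_left _ _).trans hd
    · exact (min_le_right _ _).trans hd

theorem infDist_triple {Δ : Finset Plane} {p q r : Plane} (hΔ : (Δ : Set Plane) = {p, q, r})
    (x : Plane) :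
    Metric.infDist x (Δ : Set Plane) = min (min (dist p x) (dist q x)) (dist r x) := by
  have hm : ∀ v, v ∈ Δ ↔ v = p ∨ v = q ∨ v = r := fun v => by
    rw [← Finset.mem_coe, hΔ]; simp
  have hne : Δ.Nonempty := ⟨p, (hm p).2 (Or.inl rfl)⟩
  have h := infDist_le_iff hne x
  apply le_antisymm
  · rw [h]
    rcases min_choice (min (dist p x) (dist q x)) (dist r x) with h' | h' <;> rw [h']
    · rcases min_choice (dist p x) (dist q x) with h' | h' <;> rw [h'] <;> simp [hm]
    · exact ⟨r, by simp [hm], le_rfl⟩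
  · obtain ⟨v, hv, hd⟩ := (h _).1 le_rfl
    rcases (hm v).1 hv with rfl | rfl | rfl
    · exact ((min_le_left _ _).trans (min_le_left _ _)).trans hd
    · exact ((min_le_left _ _).trans (min_le_right _ _)).trans hd
    · exact (min_le_right _ _).trans hd

/-- The vertex `r` of the triangle `Δ = {p, q, r}` is hidden from `x` by the edge `p q`, and among
the vertices of `Δ` it is the only one at distance at most `ρ` from `x`. -/
structure Hidden (Δ : Finset Plane) (x : Plane) (ρ : ℝ) (p q r : Plane)
    (a b c : Plane →ᵃ[ℝ] ℝ) : Prop extends Bary p q r a b c where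
  set_eq : (Δ : Set Plane) = {p, q, r}
  ax : 0 ≤ a x
  bx : 0 ≤ b x
  cx : c x < 0
  hr : dist r x ≤ ρ
  hp : ρ < dist p x
  hq : ρ < dist q x

namespace Hidden

variable {Δ : Finset Plane} {x : Plane} {ρ : ℝ} {p q r : Plane} {a b c : Plane →ᵃ[ℝ] ℝ}

theorem p_mem (h : Hidden Δ x ρ p q r a b c) : p ∈ Δ := by
  rw [← Finset.mem_coe, h.set_eq]; simp

theorem q_mem (h : Hidden Δ x ρ p q r a b c) : q ∈ Δ := by
  rw [← Finset.mem_coe, h.set_eq]; simp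

theorem r_mem (h : Hidden Δ x ρ p q r a b c) : r ∈ Δ := by
  rw [← Finset.mem_coe, h.set_eq]; simp

theorem notMem_hull (h : Hidden Δ x ρ p q r a b c) : x ∉ convexHull ℝ (Δ : Set Plane) := by
  rw [h.toBary.mem_hull_iff h.set_eq]
  rintro ⟨_, _, h'⟩
  linarith [h.cx]

theorem infDist_le (h : Hidden Δ x ρ p q r a b c) : Metric.infDist x (Δ : Set Plane) ≤ ρ :=
  (infDist_le_iff ⟨r, h.r_mem⟩ x ρ).2 ⟨r, h.r_mem, h.hr⟩

theorem lt_infDist (h : Hidden Δ x ρ p q r a b c) :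
    ρ < Metric.infDist x (visibleVertices Δ x) := by
  rw [h.toBary.visible_eq_of_hidden h.set_eq h.ax h.bx h.cx, infDist_pair]
  exact lt_min h.hp h.hq

end Hidden

namespace IsTriangle

variable {Δ : Finset Plane} {x : Plane}

theorem nonempty (h : IsTriangle Δ) : Δ.Nonempty := by
  rw [← Finset.card_pos, h.1]; norm_num

/-- Converse of `Hidden.infDist_le` and `Hidden.lt_infDist`. A vertex within `ρ` cannot be visible,
so `x` lies in the cone at that vertex and, being outside the triangle, beyond the opposite edge;
both ends of this edge are visible, hence farther than `ρ`. -/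
theorem exists_hidden (h : IsTriangle Δ) (hx : x ∉ convexHull ℝ (Δ : Set Plane)) {ρ : ℝ}
    (h1 : Metric.infDist x (Δ : Set Plane) ≤ ρ)
    (h2 : ρ < Metric.infDist x (visibleVertices Δ x)) :
    ∃ p q r a b c, Hidden Δ x ρ p q r a b c := by
  obtain ⟨r, hr, hd⟩ := (infDist_le_iff h.nonempty x ρ).1 h1
  obtain ⟨p, q, a, b, c, hB, hΔ⟩ := h.exists_bary hr
  have hv : ∀ v ∈ visibleVertices Δ x, ρ < dist v x := fun v hv => by
    rw [dist_comm]
    exact h2.trans_le (Metric.infDist_le_dist_of_mem hv)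
  have hrv : r ∉ visibleVertices Δ x := fun h' => absurd (hv r h') (not_lt.2 hd)
  rw [hB.mem_visible_iff hΔ] at hrv
  push Not at hrv
  rw [hB.mem_hull_iff hΔ] at hx
  have hc : c x < 0 := by
    by_contra! h'
    exact hx ⟨hrv.2.1, hrv.2.2, h'⟩
  have he := hB.visible_eq_of_hidden hΔ hrv.2.1 hrv.2.2 hc
  exact ⟨p, q, r, a, b, c, { hB with
    set_eq := hΔ
    ax := hrv.2.1
    bx := hrv.2.2
    cx := hc
    hr := hd
    hp := hv p (by simp [he])
    hq := hv q (by simp [he]) }⟩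

theorem visible_nonempty (h : IsTriangle Δ) (hx : x ∉ convexHull ℝ (Δ : Set Plane)) :
    (visibleVertices Δ x).Nonempty := by
  obtain ⟨r, hr⟩ := h.nonempty
  obtain ⟨p, q, a, b, c, hB, hΔ⟩ := h.exists_bary hr
  by_cases hv : a x < 0 ∨ b x < 0
  · exact ⟨r, (hB.mem_visible_iff hΔ x).2 (Or.inr hv)⟩
  · push Not at hv
    rw [hB.mem_hull_iff hΔ] at hx
    have hc : c x < 0 := by
      by_contra! h'
      exact hx ⟨hv.1, hv.2, h'⟩
    rw [hB.visible_eq_of_hidden hΔ hv.1 hv.2 hc]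
    simp

theorem infDist_le_visible (h : IsTriangle Δ) (hx : x ∉ convexHull ℝ (Δ : Set Plane)) :
    Metric.infDist x (Δ : Set Plane) ≤ Metric.infDist x (visibleVertices Δ x) :=
  Metric.infDist_le_infDist_of_subset (fun _ hv => hv.1) (h.visible_nonempty hx)

theorem local_nonpos (h : IsTriangle Δ) (hx : x ∉ convexHull ℝ (Δ : Set Plane)) :
    localTriangle Δ x ≤ 0 := by
  have := pow_le_pow_left₀ Metric.infDist_nonneg (h.infDist_le_visible hx) 2
  unfold localTriangle
  linarith

end IsTriangle

theorem localTriangle_of_mem {Δ : Finset Plane} {x : Plane} (hx : x ∈ Δ) :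
    localTriangle Δ x = 0 := by
  have hv : x ∈ visibleVertices Δ x := by
    refine ⟨hx, ?_⟩
    rw [segment_same]
    exact Set.inter_eq_left.2 (by simpa using subset_convexHull ℝ _ (Finset.mem_coe.2 hx))
  unfold localTriangle
  rw [Metric.infDist_zero_of_mem hv, Metric.infDist_zero_of_mem (Finset.mem_coe.2 hx)]
  ring

/-- From a point of the triangle that is not a vertex no vertex is visible, since the segment
already contains `x`, and the default value `0` applies. At a vertex both distances vanish. -/
theorem localTriangle_of_mem_hull {Δ : Finset Plane} {x : Plane}
    (hx : x ∈ convexHull ℝ (Δ : Set Plane)) :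
    localTriangle Δ x = Metric.infDist x (Δ : Set Plane) ^ 2 := by
  by_cases hxΔ : x ∈ Δ
  · rw [localTriangle_of_mem hxΔ, Metric.infDist_zero_of_mem (Finset.mem_coe.2 hxΔ)]
    ring
  · have hv : visibleVertices Δ x = ∅ := by
      ext v
      simp only [Set.mem_empty_iff_false, iff_false]
      rintro ⟨hv, he⟩
      have : x ∈ segment ℝ x v ∩ convexHull ℝ (Δ : Set Plane) :=
        ⟨left_mem_segment ℝ _ _, hx⟩
      rw [he] at this
      exact hxΔ (this ▸ hv)
    unfold localTriangle
    rw [hv, Metric.infDist_empty]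
    ring

/-! ### Chords of the disk of radius `ρ` around `x` -/

theorem exists_crossing (l : Plane →ᵃ[ℝ] ℝ) {y z : Plane} (hy : l y ≤ 0) (hz : 0 < l z) :
    ∃ u v : ℝ, 0 < u ∧ 0 ≤ v ∧ u + v = 1 ∧ l (u • y + v • z) = 0 := by
  have hd : 0 < l z - l y := by linarith
  have hs : l z / (l z - l y) + -l y / (l z - l y) = 1 := by field_simp; ring
  refine ⟨l z / (l z - l y), -l y / (l z - l y), by positivity,
    div_nonneg (by linarith) hd.le, hs, ?_⟩
  rw [affine_comb₂ _ _ _ _ _ hs]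
  field_simp
  ring

theorem dist_comb_le {x y z : Plane} {ρ u v : ℝ} (hy : dist y x ≤ ρ) (hz : dist z x ≤ ρ)
    (hu : 0 ≤ u) (hv : 0 ≤ v) (huv : u + v = 1) : dist (u • y + v • z) x ≤ ρ := by
  have := (convex_closedBall x ρ) (Metric.mem_closedBall.2 hy) (Metric.mem_closedBall.2 hz) hu hv huv
  exact Metric.mem_closedBall.1 this

namespace Bary

variable {p q r : Plane} {a b c : Plane →ᵃ[ℝ] ℝ} {Δ : Finset Plane}

/-- The disk cuts a chord from the line `c = 0`. The only zero of `a` on this line is `q`, which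
lies outside the disk, so `a` keeps its sign along the chord. -/
theorem chord_pos_left (h : Bary p q r a b c) {x y z : Plane} {ρ : ℝ} (hq : ρ < dist q x)
    (hy : dist y x ≤ ρ) (hz : dist z x ≤ ρ) (hcy : c y = 0) (hcz : c z = 0) (hay : 0 ≤ a y) :
    0 < a z := by
  by_contra! haz
  have h2 : ∀ w, c w = 0 → a w = 0 → w = q := by
    intro w hc ha
    have hb : b w = 1 := by linarith [h.sum w]
    have := h.comb w
    simpa [hc, ha, hb] using this.symm
  have key : ∃ w, dist w x ≤ ρ ∧ w = q := by
    rcases hay.eq_or_lt with h0 | h0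
    · exact ⟨y, hy, h2 y hcy h0.symm⟩
    · obtain ⟨u, v, hu, hv, huv, he⟩ := exists_crossing a haz h0
      refine ⟨u • z + v • y, dist_comb_le hz hy hu.le hv huv, h2 _ ?_ he⟩
      rw [affine_comb₂ _ _ _ _ _ huv, hcy, hcz]
      ring
  obtain ⟨w, hw, rfl⟩ := key
  linarith

/-- If `r` is close to `x`, `p` and `q` are far from `x`, the edge `p q` contains a point close to
`x`, and the line `p q` separates `x` from `r`, then `p q` hides `r` from `x`. -/
theorem hidden_of_edge (h : Bary p q r a b c) (hΔ : (Δ : Set Plane) = {p, q, r}) {x y : Plane}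
    {ρ : ℝ} (hr : dist r x ≤ ρ) (hp : ρ < dist p x) (hq : ρ < dist q x) (hy : dist y x ≤ ρ)
    (hay : 0 ≤ a y) (hby : 0 ≤ b y) (hcy : c y = 0) (hcx : c x < 0) :
    Hidden Δ x ρ p q r a b c := by
  have hρ : dist x x ≤ ρ := by
    rw [dist_self]
    exact dist_nonneg.trans hr
  -- The segment from `x` to `r` stays in the disk, so it crosses the line `p q` on the same chord
  -- as `y`, where `a` and `b` are positive. As both vanish at `r`, their signs carry over to `x`.
  obtain ⟨u, v, hu, hv, huv, he⟩ := exists_crossing c hcx.le (by rw [h.cr]; norm_num : 0 < c r)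
  have hd := dist_comb_le hρ hr hu.le hv huv
  have h1 := h.chord_pos_left hq hy hd hcy he hay
  have h2 := h.swap.chord_pos_left hp hy hd hcy he hby
  rw [affine_comb₂ _ _ _ _ _ huv, h.ar] at h1
  rw [affine_comb₂ _ _ _ _ _ huv, h.br] at h2
  refine { h with set_eq := hΔ, cx := hcx, hr := hr, hp := hp, hq := hq, ax := ?_, bx := ?_ }
  · exact (pos_of_mul_pos_right (by linarith : 0 < u * a x) hu.le).le
  · exact (pos_of_mul_pos_right (by linarith : 0 < u * b x) hu.le).le

end Bary

namespace Hidden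

variable {Δ : Finset Plane} {x : Plane} {ρ : ℝ} {p q r : Plane} {a b c : Plane →ᵃ[ℝ] ℝ}

theorem dist_self_le (h : Hidden Δ x ρ p q r a b c) : dist x x ≤ ρ := by
  rw [dist_self]
  exact dist_nonneg.trans h.hr

/-- The segment from `x` to `r` lies in the disk and meets the edge `p q`. The ends of this edge are
outside the disk, so the entire chord lies in the interior of the edge. -/
theorem chord_pos (h : Hidden Δ x ρ p q r a b c) {z : Plane} (hz : dist z x ≤ ρ) (hcz : c z = 0) :
    0 < a z ∧ 0 < b z := by
  have hB := h.toBary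
  obtain ⟨u, v, hu, hv, huv, he⟩ :=
    exists_crossing c h.cx.le (by rw [hB.cr]; norm_num : 0 < c r)
  have hd := dist_comb_le h.dist_self_le h.hr hu.le hv huv
  refine ⟨hB.chord_pos_left h.hq hd hz he hcz ?_, hB.swap.chord_pos_left h.hp hd hz he hcz ?_⟩
  · rw [affine_comb₂ _ _ _ _ _ huv, hB.ar]
    have := mul_nonneg hu.le h.ax
    linarith
  · rw [affine_comb₂ _ _ _ _ _ huv, hB.br]
    have := mul_nonneg hu.le h.bx
    linarith

/-- If the circumcircle of a triangle with a hidden vertex does not enclose a point `s` close to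
`x`, then `s` lies strictly beyond the hiding edge. -/
theorem pos_of_le_dist (h : Hidden Δ x ρ p q r a b c) {o : Plane} {R : ℝ}
    (ho : ∀ v ∈ Δ, dist v o = R) {s : Plane} (hs : dist s x ≤ ρ) (hso : R ≤ dist s o) :
    0 < c s := by
  by_contra! hcs
  have hB := h.toBary
  obtain ⟨u, v, hu, hv, huv, he⟩ := exists_crossing c hcs (by rw [hB.cr]; norm_num : 0 < c r)
  have hd := dist_comb_le hs h.hr hu.le hv huv
  obtain ⟨ha, hb⟩ := h.chord_pos hd he
  have hρ : 0 ≤ ρ := dist_nonneg.trans h.hr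
  have hR : 0 ≤ R := by rw [← ho p h.p_mem]; exact dist_nonneg
  -- The function `powDiff o x` is affine, smaller than `R ^ 2 - ρ ^ 2` at `p` and `q`, and at least
  -- this large at `r` and `s`. The crossing point is a convex combination of either pair, a
  -- contradiction.
  have e1 := hB.apply_eq (powDiff o x) (u • s + v • r)
  rw [he, affine_comb₂ _ _ _ _ _ huv] at e1
  have hsum := hB.sum (u • s + v • r)
  rw [he] at hsum
  have hp : powDiff o x p < R ^ 2 - ρ ^ 2 := by
    rw [powDiff_apply, ho p h.p_mem]
    have := pow_lt_pow_left₀ h.hp hρ (two_ne_zero)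
    linarith
  have hq : powDiff o x q < R ^ 2 - ρ ^ 2 := by
    rw [powDiff_apply, ho q h.q_mem]
    have := pow_lt_pow_left₀ h.hq hρ (two_ne_zero)
    linarith
  have hr : R ^ 2 - ρ ^ 2 ≤ powDiff o x r := by
    rw [powDiff_apply, ho r h.r_mem]
    have := pow_le_pow_left₀ dist_nonneg h.hr 2
    linarith
  have hs' : R ^ 2 - ρ ^ 2 ≤ powDiff o x s := by
    rw [powDiff_apply]
    have := pow_le_pow_left₀ dist_nonneg hs 2
    have := pow_le_pow_left₀ hR hso 2
    linarith
  have i1 := mul_lt_mul_of_pos_left hp ha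
  have i2 := mul_lt_mul_of_pos_left hq hb
  have i3 := mul_le_mul_of_nonneg_left hs' hu.le
  have i4 := mul_le_mul_of_nonneg_left hr hv
  have i5 : (u + v) * (R ^ 2 - ρ ^ 2) = R ^ 2 - ρ ^ 2 := by rw [huv, one_mul]
  have i6 : (a (u • s + v • r) + b (u • s + v • r)) * (R ^ 2 - ρ ^ 2) = R ^ 2 - ρ ^ 2 := by
    rw [add_zero] at hsum
    rw [hsum, one_mul]
  nlinarith

end Hidden

/-! ### Delaunay triangles and powers of points -/

theorem GeneralPosition.mem_of_dist_eq {S : Finset Plane} (hS : GeneralPosition S)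
    {T : Finset Plane} (hT : T ⊆ S) (h3 : T.card = 3) {o : Plane} {R : ℝ}
    (ho : ∀ v ∈ T, dist v o = R) {p : Plane} (hp : p ∈ S) (hpo : dist p o = R) : p ∈ T := by
  classical
  by_contra hpT
  refine hS (insert p T) (Finset.insert_subset hp hT) (by rw [Finset.card_insert_of_notMem hpT, h3])
    ⟨o, R, ?_⟩
  intro v hv
  simp only [Finset.coe_insert, Set.mem_insert_iff, Finset.mem_coe] at hv
  rcases hv with rfl | hv
  · exact hpo
  · exact ho v hv

theorem mem_delaunay {S T : Finset Plane} :
    T ∈ delaunay S ↔ T ⊆ S ∧ IsTriangle T ∧ EmptyCircumcircle S T := by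
  classical
  simp only [delaunay, Finset.mem_filter, Finset.mem_powersetCard, IsTriangle]
  tauto

section Delaunay

variable {S : Finset Plane} {x : Plane} {ρ : ℝ}
  {T : Finset Plane} {p q r : Plane} {a b c : Plane →ᵃ[ℝ] ℝ}

theorem Hidden.pos_of_delaunay (h : Hidden T x ρ p q r a b c) (hT : T ∈ delaunay S)
    {s : Plane} (hs : s ∈ S) (hd : dist s x ≤ ρ) : 0 < c s := by
  obtain ⟨-, -, o, R, ho, hR⟩ := mem_delaunay.1 hT
  exact h.pos_of_le_dist ho hd (hR s hs)

/-- The difference of the powers with respect to two circles. -/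
def circleDiff (o' : Plane) (R' : ℝ) (o : Plane) (R : ℝ) : Plane →ᵃ[ℝ] ℝ :=
  powDiff o' o - AffineMap.const ℝ Plane (R' ^ 2 - R ^ 2)

theorem circleDiff_apply (o' : Plane) (R' : ℝ) (o : Plane) (R : ℝ) (y : Plane) :
    circleDiff o' R' o R y = (dist y o' ^ 2 - R' ^ 2) - (dist y o ^ 2 - R ^ 2) := by
  simp only [circleDiff, AffineMap.coe_sub, Pi.sub_apply, powDiff_apply, AffineMap.const_apply]
  ring

theorem sq_dist_eq_iff {o y : Plane} {R : ℝ} (hR : 0 ≤ R) : dist y o ^ 2 = R ^ 2 ↔ dist y o = R :=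
  pow_left_inj₀ dist_nonneg hR two_ne_zero

/-- Two hidden Delaunay triangles are ordered by the powers of the view point. -/
theorem Hidden.power_lt (hS : GeneralPosition S) (h : Hidden T x ρ p q r a b c)
    (hT : T ∈ delaunay S) {T' : Finset Plane} {p' q' r' : Plane} {a' b' c' : Plane →ᵃ[ℝ] ℝ}
    (h' : Hidden T' x ρ p' q' r' a' b' c') (hT' : T' ∈ delaunay S) (hne : T' ≠ T)
    {o o' : Plane} {R R' : ℝ} (ho : ∀ v ∈ T, dist v o = R) (hoS : ∀ s ∈ S, R ≤ dist s o)
    (ho' : ∀ v ∈ T', dist v o' = R') (hoS' : ∀ s ∈ S, R' ≤ dist s o') :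
    circleDiff o' R' o R x < 0 := by
  obtain ⟨hTS, hTt, -⟩ := mem_delaunay.1 hT
  obtain ⟨hTS', hTt', -⟩ := mem_delaunay.1 hT'
  have hB := h.toBary
  have hB' := h'.toBary
  have hR : 0 ≤ R := by rw [← ho p h.p_mem]; exact dist_nonneg
  have hR' : 0 ≤ R' := by rw [← ho' p' h'.p_mem]; exact dist_nonneg
  -- Since both circles are empty, `H` is nonnegative on `T` and nonpositive on `T'`. By general
  -- position it vanishes at a vertex of `T'` only if this vertex also belongs to `T`.
  set H := circleDiff o' R' o R with hH
  have hpos : ∀ v ∈ T, 0 ≤ H v := by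
    intro v hv
    rw [hH, circleDiff_apply, ho v hv]
    have := pow_le_pow_left₀ hR' (hoS' v (hTS hv)) 2
    linarith
  have hneg : ∀ v ∈ T', H v ≤ 0 := by
    intro v hv
    rw [hH, circleDiff_apply, ho' v hv]
    have := pow_le_pow_left₀ hR (hoS v (hTS' hv)) 2
    linarith
  have hmem : ∀ v ∈ T', H v = 0 → v ∈ T := by
    intro v hv h0
    rw [hH, circleDiff_apply, ho' v hv] at h0
    exact hS.mem_of_dist_eq hTS hTt.1 ho (hTS' hv) ((sq_dist_eq_iff hR).1 (by linarith))
  have hcr : 0 < c' r := h'.pos_of_delaunay hT' (hTS h.r_mem) h.hr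
  -- The segment from `x` to `r` crosses the interior of the edge `p' q'`, where `H` is at most `0`,
  -- while `H r` is at least `0`. So `H x` cannot be positive, and the rest of the proof excludes `H
  -- x = 0`.
  obtain ⟨u, v, hu, hv, huv, he⟩ := exists_crossing c' h'.cx.le hcr
  have hd := dist_comb_le h.dist_self_le h.hr hu.le hv huv
  obtain ⟨ha, hb⟩ := h'.chord_pos hd he
  have e1 := hB'.apply_eq H (u • x + v • r)
  rw [he, affine_comb₂ _ _ _ _ _ huv] at e1
  have i1 : a' (u • x + v • r) * H p' ≤ 0 :=
    mul_nonpos_of_nonneg_of_nonpos ha.le (hneg _ h'.p_mem)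
  have i2 : b' (u • x + v • r) * H q' ≤ 0 :=
    mul_nonpos_of_nonneg_of_nonpos hb.le (hneg _ h'.q_mem)
  have i3 : 0 ≤ v * H r := mul_nonneg hv (hpos _ h.r_mem)
  by_contra! hx
  have i4 : 0 ≤ u * H x := mul_nonneg hu.le hx
  -- In the case of equality `p'` and `q'` are vertices of `T`, different from `r` because they are
  -- far from `x`. So the two triangles share the hiding edge, and `H`, vanishing on this edge and
  -- at `x` off its line, is identically zero; then both have the same vertices.
  have hp0 : H p' = 0 := by
    have : a' (u • x + v • r) * H p' = 0 := by linarith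
    exact (mul_eq_zero.1 this).resolve_left ha.ne'
  have hq0 : H q' = 0 := by
    have : b' (u • x + v • r) * H q' = 0 := by linarith
    exact (mul_eq_zero.1 this).resolve_left hb.ne'
  have hx0 : H x = 0 := by
    have : u * H x = 0 := by linarith
    exact (mul_eq_zero.1 this).resolve_left hu.ne'
  have hpT : p' ∈ T := hmem _ h'.p_mem hp0
  have hqT : q' ∈ T := hmem _ h'.q_mem hq0
  have hpr : p' ≠ r := by
    rintro rfl
    linarith [h.hr, h'.hp]
  have hqr : q' ≠ r := by
    rintro rfl
    linarith [h.hr, h'.hq]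
  have hpq : p' ≠ q' := by
    rintro rfl
    linarith [hB'.ap, hB'.aq]
  have hTe := h.set_eq
  rw [← Finset.mem_coe, hTe] at hpT hqT
  simp only [Set.mem_insert_iff, Set.mem_singleton_iff, hpr, hqr, or_false] at hpT hqT
  have hHp : H p = 0 ∧ H q = 0 := by
    rcases hpT with rfl | rfl <;> rcases hqT with rfl | rfl
    · exact absurd rfl hpq
    · exact ⟨hp0, hq0⟩
    · exact ⟨hq0, hp0⟩
    · exact absurd rfl hpq
  have e2 := hB.apply_eq H x
  rw [hHp.1, hHp.2, hx0] at e2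
  have hHr : H r = 0 := by
    have : c x * H r = 0 := by linarith
    exact (mul_eq_zero.1 this).resolve_left h.cx.ne
  have hz : H r' = 0 := by
    have := hB.apply_eq H r'
    rw [hHp.1, hHp.2, hHr] at this
    linarith
  apply hne
  apply Finset.eq_of_subset_of_card_le
  · intro w hw
    apply hmem w hw
    rw [← Finset.mem_coe, h'.set_eq] at hw
    rcases hw with rfl | rfl | rfl <;> assumption
  · rw [hTt.1, hTt'.1]

/-- Applied in both directions, `Hidden.power_lt` gives strict inequalities of opposite sign for the
same difference of powers. -/
theorem Hidden.unique (hS : GeneralPosition S) (h : Hidden T x ρ p q r a b c)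
    (hT : T ∈ delaunay S) {T' : Finset Plane} {p' q' r' : Plane} {a' b' c' : Plane →ᵃ[ℝ] ℝ}
    (h' : Hidden T' x ρ p' q' r' a' b' c') (hT' : T' ∈ delaunay S) : T' = T := by
  by_contra hne
  obtain ⟨-, -, o, R, ho, hoS⟩ := mem_delaunay.1 hT
  obtain ⟨-, -, o', R', ho', hoS'⟩ := mem_delaunay.1 hT'
  have h1 := h.power_lt hS hT h' hT' hne ho hoS ho' hoS'
  have h2 := h'.power_lt hS hT' h hT (Ne.symm hne) ho' hoS' ho hoS
  rw [circleDiff_apply] at h1 h2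
  linarith

/-- A Delaunay triangle that contains the view point has no vertex closer than the edges that
hide vertices of other Delaunay triangles. -/
theorem Hidden.lt_dist_of_mem_hull (hS : GeneralPosition S) (h : Hidden T x ρ p q r a b c)
    (hT : T ∈ delaunay S) {T₀ : Finset Plane} (hT₀ : T₀ ∈ delaunay S)
    (hx : x ∈ convexHull ℝ (T₀ : Set Plane)) {w : Plane} (hw : w ∈ T₀) : ρ < dist w x := by
  by_contra! hwd
  obtain ⟨hTS, hTt, o, R, ho, hoS⟩ := mem_delaunay.1 hT
  obtain ⟨hTS', hTt', o', R', ho', hoS'⟩ := mem_delaunay.1 hT₀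
  have hB := h.toBary
  have hR : 0 ≤ R := by rw [← ho p h.p_mem]; exact dist_nonneg
  have hR' : 0 ≤ R' := by rw [← ho' w hw]; exact dist_nonneg
  set H := circleDiff o' R' o R with hH
  have hpos : ∀ v ∈ T, 0 ≤ H v := by
    intro v hv
    rw [hH, circleDiff_apply, ho v hv]
    have := pow_le_pow_left₀ hR' (hoS' v (hTS hv)) 2
    linarith
  have hneg : ∀ v ∈ T₀, H v ≤ 0 := by
    intro v hv
    rw [hH, circleDiff_apply, ho' v hv]
    have := pow_le_pow_left₀ hR (hoS v (hTS' hv)) 2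
    linarith
  have hmem : ∀ v ∈ T, H v = 0 → v ∈ T₀ := by
    intro v hv h0
    rw [hH, circleDiff_apply, ho v hv] at h0
    exact hS.mem_of_dist_eq hTS' hTt'.1 ho' (hTS hv) ((sq_dist_eq_iff hR').1 (by linarith))
  obtain ⟨p₀, q₀, a₀, b₀, c₀, hB₀, hset₀⟩ := hTt'.exists_bary hw
  have hp₀ : p₀ ∈ T₀ := by rw [← Finset.mem_coe, hset₀]; simp
  have hq₀ : q₀ ∈ T₀ := by rw [← Finset.mem_coe, hset₀]; simp
  obtain ⟨ha₀, hb₀, hc₀⟩ := (hB₀.mem_hull_iff hset₀ x).1 hx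
  have hHx : H x ≤ 0 := by
    rw [hB₀.apply_eq H x]
    have := mul_nonpos_of_nonneg_of_nonpos ha₀ (hneg p₀ hp₀)
    have := mul_nonpos_of_nonneg_of_nonpos hb₀ (hneg q₀ hq₀)
    have := mul_nonpos_of_nonneg_of_nonpos hc₀ (hneg w hw)
    linarith
  have hcw : 0 < c w := h.pos_of_delaunay hT (hTS' hw) hwd
  -- At the crossing of the segment from `x` to `w` with the edge `p q` the function `H` is both
  -- nonnegative and nonpositive. Hence it vanishes at `p` and `q`, which are then the other two
  -- vertices of `T₀`, so all of `T₀`, including `x`, lies on the side of `w`, contrary to `c x <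
  -- 0`.
  obtain ⟨u, v, hu, hv, huv, he⟩ := exists_crossing c h.cx.le hcw
  have hd := dist_comb_le h.dist_self_le hwd hu.le hv huv
  obtain ⟨ha, hb⟩ := h.chord_pos hd he
  have e1 := hB.apply_eq H (u • x + v • w)
  rw [he, affine_comb₂ _ _ _ _ _ huv] at e1
  have i1 : 0 ≤ a (u • x + v • w) * H p := mul_nonneg ha.le (hpos _ h.p_mem)
  have i2 : 0 ≤ b (u • x + v • w) * H q := mul_nonneg hb.le (hpos _ h.q_mem)
  have i3 : v * H w ≤ 0 := mul_nonpos_of_nonneg_of_nonpos hv (hneg _ hw)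
  have i4 : u * H x ≤ 0 := mul_nonpos_of_nonneg_of_nonpos hu.le hHx
  have hp0 : H p = 0 := by
    have : a (u • x + v • w) * H p = 0 := by linarith
    exact (mul_eq_zero.1 this).resolve_left ha.ne'
  have hq0 : H q = 0 := by
    have : b (u • x + v • w) * H q = 0 := by linarith
    exact (mul_eq_zero.1 this).resolve_left hb.ne'
  have hpT : p ∈ T₀ := hmem _ h.p_mem hp0
  have hqT : q ∈ T₀ := hmem _ h.q_mem hq0
  have hpw : p ≠ w := by
    rintro rfl
    linarith [hB.cp]
  have hqw : q ≠ w := by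
    rintro rfl
    linarith [hB.cq]
  have hpq : p ≠ q := by
    rintro rfl
    linarith [hB.ap, hB.aq]
  have hcx : 0 ≤ c x := by
    rw [hB₀.apply_eq c x]
    have hcp : c p₀ = 0 ∧ c q₀ = 0 := by
      rw [← Finset.mem_coe, hset₀] at hpT hqT
      simp only [Set.mem_insert_iff, Set.mem_singleton_iff, hpw, hqw, or_false] at hpT hqT
      rcases hpT with rfl | rfl <;> rcases hqT with rfl | rfl
      · exact absurd rfl hpq
      · exact ⟨hB.cp, hB.cq⟩
      · exact ⟨hB.cq, hB.cp⟩
      · exact absurd rfl hpq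
    rw [hcp.1, hcp.2]
    have := mul_nonneg hc₀ hcw.le
    linarith
  linarith [h.cx]

end Delaunay

/-! ### Generic points and the covering by Delaunay triangles -/

/-- The union of the lines through pairs of points of `S`. -/
def lineUnion (S : Finset Plane) : Set Plane :=
  ⋃ p ∈ S, ⋃ q ∈ S, (affineSpan ℝ ({p, q} : Set Plane) : Set Plane)

theorem volume_line (p q : Plane) :
    volume (affineSpan ℝ ({p, q} : Set Plane) : Set Plane) = 0 := by
  apply Measure.addHaar_affineSubspace
  intro h
  have h1 := congrArg AffineSubspace.direction h
  rw [direction_affineSpan, AffineSubspace.direction_top] at h1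
  have h2 : Module.finrank ℝ (vectorSpan ℝ ({p, q} : Set Plane)) ≤ 1 := by
    rw [vectorSpan_pair_rev]
    exact (finrank_span_le_card _).trans (by simp)
  rw [h1, finrank_top] at h2
  simp at h2

theorem volume_lineUnion (S : Finset Plane) : volume (lineUnion S) = 0 := by
  unfold lineUnion
  refine (measure_biUnion_null_iff S.countable_toSet).2 fun p _ => ?_
  exact (measure_biUnion_null_iff S.countable_toSet).2 fun q _ => volume_line p q

theorem hull_subset_lineUnion {S t : Finset Plane} (ht : t ⊆ S) (hne : t.Nonempty)
    (h2 : t.card ≤ 2) : convexHull ℝ (t : Set Plane) ⊆ lineUnion S := by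
  classical
  have key : ∃ p ∈ S, ∃ q ∈ S, (t : Set Plane) ⊆ {p, q} := by
    have h0 := Finset.card_pos.2 hne
    interval_cases h : t.card
    · obtain ⟨p, rfl⟩ := Finset.card_eq_one.1 h
      exact ⟨p, ht (by simp), p, ht (by simp), by simp⟩
    · obtain ⟨p, q, -, rfl⟩ := Finset.card_eq_two.1 h
      exact ⟨p, ht (by simp), q, ht (by simp), by simp⟩
  obtain ⟨p, hp, q, hq, h⟩ := key
  intro y hy
  have : y ∈ (affineSpan ℝ ({p, q} : Set Plane) : Set Plane) :=
    convexHull_subset_affineSpan _ (convexHull_mono h hy)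
  exact Set.mem_biUnion hp (Set.mem_biUnion hq this)

theorem card_le_three {t : Finset Plane} (h : AffineIndependent ℝ ((↑) : t → Plane)) :
    t.card ≤ 3 := by
  have h1 := h.card_le_finrank_succ
  have h2 := Submodule.finrank_le (vectorSpan ℝ (Set.range ((↑) : t → Plane)))
  have h3 : Module.finrank ℝ Plane = 2 := finrank_euclideanSpace_fin
  rw [Fintype.card_coe] at h1
  omega

theorem isTriangle_of_generic {S t : Finset Plane} (ht : t ⊆ S)
    (h : AffineIndependent ℝ ((↑) : t → Plane)) {x : Plane} (hx : x ∈ convexHull ℝ (t : Set Plane))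
    (hxN : x ∉ lineUnion S) : IsTriangle t := by
  refine ⟨le_antisymm (card_le_three h) ?_, h⟩
  by_contra! hlt
  have hne : t.Nonempty := by
    have : (t : Set Plane).Nonempty := convexHull_nonempty_iff.1 ⟨x, hx⟩
    simpa using this
  exact hxN (hull_subset_lineUnion ht hne (by omega) hx)

theorem exists_triangle_of_generic {S U : Finset Plane} (hU : U ⊆ S) {x : Plane}
    (hx : x ∈ convexHull ℝ (U : Set Plane)) (hxN : x ∉ lineUnion S) :
    ∃ T ⊆ U, IsTriangle T ∧ x ∈ convexHull ℝ (T : Set Plane) := by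
  rw [convexHull_eq_union] at hx
  simp only [Set.mem_iUnion] at hx
  obtain ⟨t, htU, hti, hxt⟩ := hx
  have htU' : t ⊆ U := by exact_mod_cast htU
  exact ⟨t, htU', isTriangle_of_generic (htU'.trans hU) hti hxt hxN, hxt⟩

/-- A closed set that contains almost all points of a convex set with interior contains it. -/
theorem subset_of_generic {S : Finset Plane} {C U : Set Plane} (hC : Convex ℝ C)
    (hi : (interior C).Nonempty) (hU : IsClosed U) (h : ∀ x ∈ C, x ∉ lineUnion S → x ∈ U) :
    C ⊆ U := by
  have h0 : volume (interior C \ U) = 0 := by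
    apply measure_mono_null _ (volume_lineUnion S)
    rintro x ⟨hx, hxU⟩
    by_contra hxN
    exact hxU (h x (interior_subset hx) hxN)
  rw [(isOpen_interior.sdiff hU).measure_eq_zero_iff volume, Set.sdiff_eq_empty] at h0
  calc C ⊆ closure C := subset_closure
    _ = closure (interior C) := (hC.closure_interior_eq_closure_of_nonempty_interior hi).symm
    _ ⊆ U := closure_minimal h0 hU

theorem isClosed_biUnion_hull (F : Finset (Finset Plane)) :
    IsClosed (⋃ T ∈ F, convexHull ℝ (T : Set Plane)) :=
  F.finite_toSet.isClosed_biUnion fun T _ => T.finite_toSet.isCompact_convexHull ℝ |>.isClosed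

theorem IsTriangle.exists_circle {T : Finset Plane} (h : IsTriangle T) :
    ∃ (o : Plane) (R : ℝ), ∀ v ∈ T, dist v o = R := by
  have : Nonempty T := h.nonempty.to_subtype
  obtain ⟨⟨o, R⟩, ⟨-, hs⟩, -⟩ := h.2.existsUnique_dist_eq
  refine ⟨o, R, fun v hv => ?_⟩
  exact hs ⟨⟨v, hv⟩, rfl⟩

/-- A pivot as in the simplex method: `s` replaces the vertex at which the ratio of the coordinate
of `s` to that of `x` is largest. This ratio test keeps the weights of `x` on the other two vertices
nonnegative. -/
theorem exists_exchange {S : Finset Plane} {x s p q r : Plane}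
    {a b c : Plane →ᵃ[ℝ] ℝ} (hB : Bary p q r a b c)
    (hp : p ∈ S) (hq : q ∈ S) (hs : s ∈ S)
    (ha : 0 < a x) (hb : 0 < b x) (hc : 0 < c x) (hxN : x ∉ lineUnion S)
    (h1 : a s / a x ≤ c s / c x) (h2 : b s / b x ≤ c s / c x) :
    ∃ T, T ⊆ S ∧ IsTriangle T ∧ x ∈ convexHull ℝ (T : Set Plane) ∧ s ∈ T ∧
      (∀ v ∈ T, v = s ∨ v = p ∨ v = q) ∧
      ∀ H : Plane →ᵃ[ℝ] ℝ, H p = 0 → H q = 0 → 0 < H s → 0 < H x := by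
  classical
  rw [div_le_div_iff₀ ha hc] at h1
  rw [div_le_div_iff₀ hb hc] at h2
  -- If the largest ratio were not positive, no coordinate of `s` would be positive, although they
  -- sum to `1`.
  have hcs : 0 < c s := by
    by_contra! hcs
    have i1 : a s * c x ≤ 0 := h1.trans (mul_nonpos_of_nonpos_of_nonneg hcs ha.le)
    have i2 : b s * c x ≤ 0 := h2.trans (mul_nonpos_of_nonpos_of_nonneg hcs hb.le)
    have i3 : (a s + b s + c s) * c x = c x := by rw [hB.sum, one_mul]
    have i4 : c s * c x ≤ 0 := mul_nonpos_of_nonpos_of_nonneg hcs hc.le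
    nlinarith
  -- The multiple of `s` whose subtraction from `x` cancels the coordinate at `r`.
  set τ := c x / c s with hτ
  have hτ0 : 0 < τ := by positivity
  have hτc : τ * c s = c x := by rw [hτ]; field_simp
  have wa : 0 ≤ a x - τ * a s := by
    have : τ * a s ≤ a x := by
      rw [hτ, div_mul_eq_mul_div, div_le_iff₀ hcs]
      linarith
    linarith
  have wb : 0 ≤ b x - τ * b s := by
    have : τ * b s ≤ b x := by
      rw [hτ, div_mul_eq_mul_div, div_le_iff₀ hcs]
      linarith
    linarith
  have wsum : τ + (a x - τ * a s) + (b x - τ * b s) = 1 := by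
    have e1 := hB.sum x
    have e2 := hB.sum s
    linear_combination e1 - τ * e2 + hτc
  have hxe : τ • s + (a x - τ * a s) • p + (b x - τ * b s) • q = x := by
    conv_lhs => rw [show τ • s = τ • (a s • p + b s • q + c s • r) by rw [hB.comb]]
    conv_rhs => rw [← hB.comb x, ← hτc]
    module
  have hxU : x ∈ convexHull ℝ (({s, p, q} : Finset Plane) : Set Plane) := by
    have hcv := convex_convexHull ℝ ((({s, p, q} : Finset Plane)) : Set Plane)
    have := hcv.sum_mem (t := (Finset.univ : Finset (Fin 3)))
      (w := ![τ, a x - τ * a s, b x - τ * b s]) (z := ![s, p, q]) ?_ ?_ ?_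
    · rw [← hxe]
      simpa [Fin.sum_univ_three] using this
    · intro i _
      fin_cases i
      · exact hτ0.le
      · exact wa
      · exact wb
    · simpa [Fin.sum_univ_three] using wsum
    · intro i _
      apply subset_convexHull
      fin_cases i <;> simp
  have hUS : ({s, p, q} : Finset Plane) ⊆ S := by
    intro v hv
    simp only [Finset.mem_insert, Finset.mem_singleton] at hv
    rcases hv with rfl | rfl | rfl <;> assumption
  obtain ⟨T, hTU, hT, hxT⟩ := exists_triangle_of_generic hUS hxU hxN
  have hTe : T = {s, p, q} := by
    apply Finset.eq_of_subset_of_card_le hTU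
    rw [hT.1]
    exact Finset.card_le_three
  refine ⟨T, hTU.trans hUS, hT, hxT, by simp [hTe], ?_, ?_⟩
  · intro v hv
    simpa [hTe] using hv
  · intro H h1 h2 h3
    rw [← hxe, affine_comb₃ _ _ _ _ _ _ _ wsum, h1, h2]
    have := mul_pos hτ0 h3
    linarith

/-- Among the triangles spanned by `S` that contain `x`, take one whose circumcircle gives `x` the
largest power, that is, the lowest one over `x` after lifting to the paraboloid. A point `s`
enclosed by its circle could be exchanged for a vertex: the difference of the new and the old power
vanishes at the two kept vertices and is positive at `s`, hence at `x`. -/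
theorem mem_delaunay_hull_of_generic {S : Finset Plane} {x : Plane}
    (hx : x ∈ convexHull ℝ (S : Set Plane)) (hxN : x ∉ lineUnion S) :
    ∃ T ∈ delaunay S, x ∈ convexHull ℝ (T : Set Plane) := by
  classical
  set F := (S.powersetCard 3).filter
    (fun T => IsTriangle T ∧ x ∈ convexHull ℝ (T : Set Plane)) with hF
  have hFm : ∀ T, T ∈ F ↔ T ⊆ S ∧ IsTriangle T ∧ x ∈ convexHull ℝ (T : Set Plane) := by
    intro T
    simp only [hF, Finset.mem_filter, Finset.mem_powersetCard]
    constructor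
    · rintro ⟨⟨h1, -⟩, h2⟩
      exact ⟨h1, h2⟩
    · rintro ⟨h1, h2⟩
      exact ⟨⟨h1, h2.1.1⟩, h2⟩
  have hFne : F.Nonempty := by
    obtain ⟨T, hTS, hT, hxT⟩ := exists_triangle_of_generic (Finset.Subset.refl S) hx hxN
    exact ⟨T, (hFm T).2 ⟨hTS, hT, hxT⟩⟩
  have hcirc : ∀ T : Finset Plane, ∃ oR : Plane × ℝ, IsTriangle T → ∀ v ∈ T, dist v oR.1 = oR.2 := by
    intro T
    by_cases hT : IsTriangle T
    · obtain ⟨o, R, h⟩ := hT.exists_circle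
      exact ⟨(o, R), fun _ => h⟩
    · exact ⟨(0, 0), fun h => absurd h hT⟩
  choose oR hoR using hcirc
  obtain ⟨T, hTF, hmax⟩ := Finset.exists_max_image F
    (fun T => dist x (oR T).1 ^ 2 - (oR T).2 ^ 2) hFne
  obtain ⟨hTS, hT, hxT⟩ := (hFm T).1 hTF
  refine ⟨T, mem_delaunay.2 ⟨hTS, hT, (oR T).1, (oR T).2, hoR T hT, ?_⟩, hxT⟩
  intro s hs
  by_contra! hlt
  have key : ∀ p q r a b c, Bary p q r a b c → (T : Set Plane) = {p, q, r} →
      0 < a x → 0 < b x → 0 < c x → a s / a x ≤ c s / c x → b s / b x ≤ c s / c x → False := by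
    intro p q r a b c hB hset ha hb hc h1 h2
    have hp : p ∈ T := by rw [← Finset.mem_coe, hset]; simp
    have hq : q ∈ T := by rw [← Finset.mem_coe, hset]; simp
    obtain ⟨T', hTS', hT', hxT', hsT', hv, hH⟩ :=
      exists_exchange hB (hTS hp) (hTS hq) hs ha hb hc hxN h1 h2
    have hm := hmax T' ((hFm T').2 ⟨hTS', hT', hxT'⟩)
    have hpq : p ∈ T' ∧ q ∈ T' := by
      have hsub : T' ⊆ {s, p, q} := by
        intro v hv'
        simpa using hv v hv'
      have hTe : T' = {s, p, q} := by
        apply Finset.eq_of_subset_of_card_le hsub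
        rw [hT'.1]
        exact Finset.card_le_three
      simp [hTe]
    have := hH (circleDiff (oR T').1 (oR T').2 (oR T).1 (oR T).2) ?_ ?_ ?_
    · rw [circleDiff_apply] at this
      linarith
    · rw [circleDiff_apply, hoR T hT p hp, hoR T' hT' p hpq.1]
      ring
    · rw [circleDiff_apply, hoR T hT q hq, hoR T' hT' q hpq.2]
      ring
    · rw [circleDiff_apply, hoR T' hT' s hsT']
      have := pow_lt_pow_left₀ hlt dist_nonneg two_ne_zero
      linarith
  obtain ⟨r, hr⟩ := hT.nonempty
  obtain ⟨p, q, a, b, c, hB, hset⟩ := hT.exists_bary hr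
  have hp : p ∈ T := by rw [← Finset.mem_coe, hset]; simp
  have hq : q ∈ T := by rw [← Finset.mem_coe, hset]; simp
  -- A vanishing coordinate would put `x` on a line through two points of `S`.
  have hne : ∀ p q r a b c, Bary p q r a b c → p ∈ T → q ∈ T → c x = 0 → False := by
    intro p q r a b c hB hp hq h0
    apply hxN
    have : x ∈ (affineSpan ℝ ({p, q} : Set Plane) : Set Plane) := by
      have hs := hB.sum x
      have hc := hB.comb x
      rw [h0] at hs hc
      have e : x = AffineMap.lineMap p q (b x) := by
        rw [AffineMap.lineMap_apply_module, ← show a x = 1 - b x by linarith]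
        simpa using hc.symm
      rw [e]
      exact AffineMap.lineMap_mem_affineSpan_pair _ _ _
    exact Set.mem_biUnion (hTS hp) (Set.mem_biUnion (hTS hq) this)
  obtain ⟨ha, hb, hc⟩ := (hB.mem_hull_iff hset x).1 hxT
  have ha' : 0 < a x := lt_of_le_of_ne ha fun h => hne _ _ _ _ _ _ hB.rotate hq hr h.symm
  have hb' : 0 < b x := lt_of_le_of_ne hb fun h => hne _ _ _ _ _ _ hB.rotate.rotate hr hp h.symm
  have hc' : 0 < c x := lt_of_le_of_ne hc fun h => hne _ _ _ _ _ _ hB hp hq h.symm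
  have hset1 := Bary.set_rotate hset
  have hset2 := Bary.set_rotate hset1
  rcases le_total (a s / a x) (c s / c x) with h1 | h1
  · rcases le_total (b s / b x) (c s / c x) with h2 | h2
    · exact key _ _ _ _ _ _ hB hset ha' hb' hc' h1 h2
    · exact key _ _ _ _ _ _ hB.rotate.rotate hset2 hc' ha' hb' h2 (h1.trans h2)
  · rcases le_total (b s / b x) (a s / a x) with h2 | h2
    · exact key _ _ _ _ _ _ hB.rotate hset1 hb' hc' ha' h2 h1
    · exact key _ _ _ _ _ _ hB.rotate.rotate hset2 hc' ha' hb' (h1.trans h2) h2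

theorem hull_subset_delaunay {S : Finset Plane}
    (hi : (interior (convexHull ℝ (S : Set Plane))).Nonempty) :
    convexHull ℝ (S : Set Plane) ⊆ ⋃ T ∈ delaunay S, convexHull ℝ (T : Set Plane) := by
  apply subset_of_generic (S := S) (convex_convexHull ℝ _) hi (isClosed_biUnion_hull _)
  intro x hx hxN
  obtain ⟨T, hT, hxT⟩ := mem_delaunay_hull_of_generic hx hxN
  exact Set.mem_biUnion hT hxT

/-! ### Triangles of a geometric triangulation -/

section Complex

variable {S : Finset Plane} {K : Geometry.SimplicialComplex ℝ Plane}

theorem mem_triangles {T : Finset Plane} : T ∈ triangles S K ↔ T ⊆ S ∧ T.card = 3 ∧ T ∈ K.faces := by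
  classical
  simp only [triangles, Finset.mem_filter, Finset.mem_powersetCard]
  tauto

theorem isTriangle_of_mem_triangles {T : Finset Plane} (h : T ∈ triangles S K) : IsTriangle T :=
  ⟨(mem_triangles.1 h).2.1, K.indep (mem_triangles.1 h).2.2⟩

theorem IsGeometricTriangulation.subset (hK : IsGeometricTriangulation S K) {t : Finset Plane}
    (ht : t ∈ K.faces) : t ⊆ S := by
  intro v hv
  have : v ∈ K.vertices := by
    rw [K.vertices_eq]
    exact Set.mem_biUnion ht hv
  rwa [hK.vertices_eq] at this

theorem IsGeometricTriangulation.mem_of_mem_hull (hK : IsGeometricTriangulation S K)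
    {T : Finset Plane} (hT : T ∈ triangles S K) {s : Plane} (hs : s ∈ S)
    (h : s ∈ convexHull ℝ (T : Set Plane)) : s ∈ T := by
  have hsv : s ∈ K.vertices := by rw [hK.vertices_eq]; exact hs
  exact (Geometry.SimplicialComplex.vertex_mem_convexHull_iff hsv (mem_triangles.1 hT).2.2).1 h

/-- A generic point lies in no face with fewer than three vertices, so the triangles cover almost
all of the hull; a finite union of triangles is closed. -/
theorem IsGeometricTriangulation.hull_subset (hK : IsGeometricTriangulation S K)
    (hi : (interior (convexHull ℝ (S : Set Plane))).Nonempty) :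
    convexHull ℝ (S : Set Plane) ⊆ ⋃ T ∈ triangles S K, convexHull ℝ (T : Set Plane) := by
  apply subset_of_generic (S := S) (convex_convexHull ℝ _) hi (isClosed_biUnion_hull _)
  intro x hx hxN
  rw [← hK.space_eq, Geometry.SimplicialComplex.mem_space_iff] at hx
  obtain ⟨t, ht, hxt⟩ := hx
  have hT := isTriangle_of_generic (hK.subset ht) (K.indep ht) hxt hxN
  exact Set.mem_biUnion (mem_triangles.2 ⟨hK.subset ht, hT.1, ht⟩) hxt

end Complex

/-! ### Finding hiding edges of a triangulation along a segment -/

open Filter Topology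

section Complex

variable {S : Finset Plane} {K : Geometry.SimplicialComplex ℝ Plane}

theorem lineMap_comb (l : Plane →ᵃ[ℝ] ℝ) (x s : Plane) (τ : ℝ) :
    l (AffineMap.lineMap x s τ) = (1 - τ) * l x + τ * l s := by
  rw [AffineMap.lineMap_apply_module, affine_comb₂ _ _ _ _ _ (by ring)]

theorem dist_lineMap_le {x s : Plane} {ρ τ : ℝ} (hs : dist s x ≤ ρ) (h0 : 0 ≤ τ) (h1 : τ ≤ 1) :
    dist (AffineMap.lineMap x s τ : Plane) x ≤ ρ := by
  rw [AffineMap.lineMap_apply_module]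
  exact dist_comb_le (by rw [dist_self]; exact dist_nonneg.trans hs) hs (by linarith) h0 (by ring)

/-- Follow a segment from `x` to a point `s` of `S` close to `x`. If it meets a triangle all of
whose vertices are far from `x`, then it runs through an edge that hides a vertex close to `x`. -/
theorem IsGeometricTriangulation.exists_hidden_of_far (hK : IsGeometricTriangulation S K)
    (hi : (interior (convexHull ℝ (S : Set Plane))).Nonempty) {x s : Plane} {ρ : ℝ}
    (hx : ∀ T ∈ triangles S K, ∀ T' ∈ triangles S K, T ≠ T' →
      x ∈ convexHull ℝ (T : Set Plane) → x ∉ convexHull ℝ (T' : Set Plane))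
    (hs : s ∈ S) (hsd : dist s x ≤ ρ) {τ₀ : ℝ} (hτ₀ : τ₀ ∈ Set.Icc (0 : ℝ) 1) {T₀ : Finset Plane}
    (hT₀ : T₀ ∈ triangles S K) (hfar : ∀ v ∈ T₀, ρ < dist v x)
    (hy₀ : AffineMap.lineMap x s τ₀ ∈ convexHull ℝ (T₀ : Set Plane)) :
    ∃ T ∈ triangles S K, ∃ p q r a b c, Hidden T x ρ p q r a b c := by
  classical
  set γ : ℝ → Plane := fun τ => AffineMap.lineMap x s τ with hγ
  have hγc : Continuous γ := AffineMap.lineMap_continuous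
  set A := (triangles S K).filter (fun T => ∀ v ∈ T, ρ < dist v x) with hA
  set N := (triangles S K).filter (fun T => ¬ ∀ v ∈ T, ρ < dist v x) with hN
  set E := Set.Icc (0 : ℝ) 1 ∩ γ ⁻¹' (⋃ T ∈ A, convexHull ℝ (T : Set Plane)) with hE
  have hEc : IsCompact E := isCompact_Icc.inter_right ((isClosed_biUnion_hull A).preimage hγc)
  have hEne : E.Nonempty :=
    ⟨τ₀, hτ₀, Set.mem_biUnion (Finset.mem_filter.2 ⟨hT₀, hfar⟩) hy₀⟩
  -- The last parameter at which the segment is in a triangle with all vertices far. After it, only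
  -- triangles with a close vertex are met; the edge passed at `t` is the hiding edge.
  obtain ⟨t, ⟨ht01, htA⟩, htmax⟩ := hEc.exists_isGreatest hEne
  simp only [Set.mem_preimage, Set.mem_iUnion, exists_prop] at htA
  obtain ⟨T₁, hT₁, hyT₁⟩ := htA
  obtain ⟨hT₁K, hT₁far⟩ := Finset.mem_filter.1 hT₁
  have hyd : dist (γ t) x ≤ ρ := dist_lineMap_le hsd ht01.1 ht01.2
  have ht1 : t < 1 := by
    rcases ht01.2.lt_or_eq with h | h
    · exact h
    · exfalso
      have : γ t = s := by simp [hγ, h]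
      rw [this] at hyT₁
      exact absurd (hT₁far s (hK.mem_of_mem_hull hT₁K hs hyT₁)) (not_lt.2 hsd)
  have hsub : ∀ T ∈ triangles S K,
      convexHull ℝ (T : Set Plane) ⊆ convexHull ℝ (S : Set Plane) := fun T hT =>
    convexHull_mono (by exact_mod_cast (mem_triangles.1 hT).1)
  have hafter : ∀ τ, t < τ → τ < 1 → ∃ T ∈ N, γ τ ∈ convexHull ℝ (T : Set Plane) := by
    intro τ h1 h2
    have hmem : γ τ ∈ convexHull ℝ (S : Set Plane) := by
      have hc := convex_convexHull ℝ (S : Set Plane)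
      have hd : 0 < 1 - t := by linarith
      have hsum : (1 - τ) / (1 - t) + (τ - t) / (1 - t) = 1 := by field_simp; ring
      have := hc (hsub T₁ hT₁K hyT₁) (subset_convexHull ℝ _ (Finset.mem_coe.2 hs))
        (div_nonneg (by linarith) hd.le) (div_nonneg (by linarith) hd.le) hsum
      convert this using 1
      simp only [hγ, AffineMap.lineMap_apply_module]
      have e1 : (1 - τ) = (1 - τ) / (1 - t) * (1 - t) := by field_simp
      have e2 : τ = (1 - τ) / (1 - t) * t + (τ - t) / (1 - t) := by field_simp; ring
      conv_lhs => rw [e1, show τ • s = ((1 - τ) / (1 - t) * t + (τ - t) / (1 - t)) • s by rw [← e2]]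
      module
    have := hK.hull_subset hi hmem
    simp only [Set.mem_iUnion, exists_prop] at this
    obtain ⟨T, hT, hTm⟩ := this
    refine ⟨T, Finset.mem_filter.2 ⟨hT, fun hf => ?_⟩, hTm⟩
    have : τ ∈ E := ⟨⟨by linarith [ht01.1], h2.le⟩,
      Set.mem_biUnion (Finset.mem_filter.2 ⟨hT, hf⟩) hTm⟩
    linarith [htmax this]
  have hev : ∀ᶠ τ in 𝓝[>] t, ∃ T ∈ N, γ τ ∈ convexHull ℝ (T : Set Plane) := by
    filter_upwards [Ioo_mem_nhdsGT ht1] with τ hτ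
    exact hafter τ hτ.1 hτ.2
  -- As there are finitely many triangles, one of them contains points of the segment arbitrarily
  -- close after `t`, and by closedness also the point at `t`.
  have hfreq : ∃ T ∈ N, ∃ᶠ τ in 𝓝[>] t, γ τ ∈ convexHull ℝ (T : Set Plane) := by
    by_contra! hcon
    have h1 : ∀ᶠ τ in 𝓝[>] t, ∀ T ∈ N, γ τ ∉ convexHull ℝ (T : Set Plane) :=
      (eventually_all_finset N).2 hcon
    obtain ⟨τ, ⟨T, hT, hTm⟩, h2⟩ := (hev.and h1).exists
    exact h2 T hT hTm
  obtain ⟨T, hTN, hTf⟩ := hfreq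
  obtain ⟨hTK, hTnear⟩ := Finset.mem_filter.1 hTN
  have hyT : γ t ∈ convexHull ℝ (T : Set Plane) :=
    (T.finite_toSet.isCompact_convexHull ℝ).isClosed.mem_of_frequently_of_tendsto hTf
      ((hγc.tendsto t).mono_left nhdsWithin_le_nhds)
  obtain ⟨τ₁, hτ₁T, hτ₁⟩ := (hTf.and_eventually (Ioo_mem_nhdsGT ht1)).exists
  have hne : T₁ ≠ T := fun h => hTnear (h ▸ hT₁far)
  have hT₁t := isTriangle_of_mem_triangles hT₁K
  have hTt := isTriangle_of_mem_triangles hTK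
  have hyI : γ t ∈ convexHull ℝ ((T₁ : Set Plane) ∩ T) :=
    K.inter_subset_convexHull (mem_triangles.1 hT₁K).2.2 (mem_triangles.1 hTK).2.2 ⟨hyT₁, hyT⟩
  have hr : ∃ r ∈ T, r ∉ T₁ := by
    by_contra! hcon
    exact hne (Finset.eq_of_subset_of_card_le hcon (by rw [hT₁t.1, hTt.1])).symm
  obtain ⟨r, hrT, hrT₁⟩ := hr
  obtain ⟨p, q, a, b, c, hB, hset⟩ := hTt.exists_bary hrT
  have hIsub : ∀ v, v ∈ T₁ → v ∈ T → v = p ∨ v = q := by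
    intro v h1 h2
    rw [← Finset.mem_coe, hset] at h2
    rcases h2 with rfl | rfl | rfl
    · simp
    · simp
    · exact absurd h1 hrT₁
  -- The common face of the two triangles is a full edge: if it had a single vertex, `γ t` would be
  -- this vertex, which is far from `x`, whereas `γ t` is close.
  have hone : ∀ w w', (∀ v, v ∈ T₁ → v ∈ T → v = w ∨ v = w') → w ∈ T₁ := by
    intro w w' hsubs
    by_contra hw
    have hI : (T₁ : Set Plane) ∩ T ⊆ {w'} := by
      rintro v ⟨h1, h2⟩
      rcases hsubs v h1 h2 with rfl | rfl
      · exact absurd h1 hw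
      · rfl
    have hyw : γ t = w' := by
      have := convexHull_mono hI hyI
      simpa using this
    have : ((T₁ : Set Plane) ∩ T).Nonempty := convexHull_nonempty_iff.1 ⟨_, hyI⟩
    obtain ⟨v, hv⟩ := this
    have hvw : v = w' := hI hv
    have := hT₁far w' (hvw ▸ hv.1)
    rw [hyw] at hyd
    linarith
  have hp : p ∈ T₁ := hone p q hIsub
  have hq : q ∈ T₁ := hone q p fun v h1 h2 => (hIsub v h1 h2).symm
  have hrd : dist r x ≤ ρ := by
    by_contra! hcon
    apply hTnear
    intro v hv
    rw [← Finset.mem_coe, hset] at hv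
    rcases hv with rfl | rfl | rfl
    · exact hT₁far _ hp
    · exact hT₁far _ hq
    · exact hcon
  have hypq : γ t ∈ convexHull ℝ {p, q} := by
    refine convexHull_mono ?_ hyI
    rintro v ⟨h1, h2⟩
    simpa using hIsub v h1 h2
  obtain ⟨hay, hby, hcy⟩ := (hB.mem_segment_iff _).1 hypq
  obtain ⟨ha1, hb1, hc1⟩ := (hB.mem_hull_iff hset _).1 hτ₁T
  -- At `c = 0` the point would be on the edge `p q` of `T₁`, against the maximality of `t`.
  have hc1' : 0 < c (γ τ₁) := by
    refine lt_of_le_of_ne hc1 fun h => ?_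
    have h1 : γ τ₁ ∈ convexHull ℝ {p, q} := (hB.mem_segment_iff _).2 ⟨ha1, hb1, h.symm⟩
    have h2 : γ τ₁ ∈ convexHull ℝ (T₁ : Set Plane) := by
      refine convexHull_mono ?_ h1
      rintro v (rfl | rfl)
      · exact hp
      · exact hq
    have : τ₁ ∈ E := ⟨⟨by linarith [ht01.1, hτ₁.1], hτ₁.2.le⟩, Set.mem_biUnion hT₁ h2⟩
    linarith [htmax this, hτ₁.1]
  have ht0 : 0 < t := by
    refine lt_of_le_of_ne ht01.1 fun h => ?_
    have : γ t = x := by simp [hγ, ← h]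
    rw [this] at hyT₁ hyT
    exact hx T₁ hT₁K T hTK hne hyT₁ hyT
  -- Along the segment `c` is affine, zero at `t` and positive at a later parameter; since `t` is
  -- positive, it is negative at the start `x`.
  have hcx : c x < 0 := by
    simp only [hγ, lineMap_comb] at hcy hc1'
    have h1 : 0 < (τ₁ - t) * (c s - c x) := by linarith
    have h2 : 0 < c s - c x := pos_of_mul_pos_right h1 (by linarith [hτ₁.1])
    have h3 := mul_pos ht0 h2
    linarith
  exact ⟨T, hTK, p, q, r, a, b, c,
    hB.hidden_of_edge hset hrd (hT₁far p hp) (hT₁far q hq) hyd hay hby hcy hcx⟩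

theorem eventually_nonneg (l : Plane →ᵃ[ℝ] ℝ) {x y : Plane}
    (h : 0 < l y ∨ (0 ≤ l y ∧ 0 ≤ l x)) :
    ∀ᶠ ε in 𝓝[>] (0 : ℝ), 0 ≤ l (AffineMap.lineMap y x ε) := by
  rcases h with h | ⟨h1, h2⟩
  · have hc : Continuous fun ε : ℝ => l (AffineMap.lineMap y x ε) := by
      simp only [lineMap_comb]
      fun_prop
    have : Tendsto (fun ε : ℝ => l (AffineMap.lineMap y x ε)) (𝓝[>] 0) (𝓝 (l y)) := by
      have := (hc.tendsto 0).mono_left (nhdsWithin_le_nhds (s := Set.Ioi (0 : ℝ)))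
      simpa using this
    filter_upwards [this.eventually (lt_mem_nhds h)] with ε hε
    exact le_of_lt hε
  · filter_upwards [Ioo_mem_nhdsGT (zero_lt_one' ℝ)] with ε hε
    rw [lineMap_comb]
    have := mul_nonneg (by linarith [hε.2] : 0 ≤ 1 - ε) h1
    have := mul_nonneg hε.1.le h2
    linarith

/-- If a convex set contains `u`, `w` and a point strictly on the same side of the line `u w` as
`x`, then it contains points close to each interior point of the edge `u w` towards `x`. -/
theorem Bary.eventually_mem {C : Set Plane} (hC : Convex ℝ C) {u w v : Plane}
    {a b c : Plane →ᵃ[ℝ] ℝ} (hB : Bary u w v a b c) (hu : u ∈ C) (hw : w ∈ C) {z : Plane}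
    (hz : z ∈ C) (hcz : c z < 0) {x y : Plane} (hcx : c x < 0) (hay : 0 < a y) (hby : 0 < b y)
    (hcy : c y = 0) : ∀ᶠ ε in 𝓝[>] (0 : ℝ), AffineMap.lineMap y x ε ∈ C := by
  -- `l₁`, `l₂`, `l₃` are the barycentric coordinates of the triangle `z u w`.
  set l₁ : Plane →ᵃ[ℝ] ℝ := (c z)⁻¹ • c with hl₁
  set l₂ : Plane →ᵃ[ℝ] ℝ := a - (a z) • l₁ with hl₂
  set l₃ : Plane →ᵃ[ℝ] ℝ := b - (b z) • l₁ with hl₃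
  have e1 : ∀ t, l₁ t = (c z)⁻¹ * c t := fun t => by simp [hl₁]
  have e2 : ∀ t, l₂ t = a t - a z * l₁ t := fun t => by simp [hl₂]
  have e3 : ∀ t, l₃ t = b t - b z * l₁ t := fun t => by simp [hl₃]
  have h1 : l₁ y = 0 := by rw [e1, hcy, mul_zero]
  filter_upwards [eventually_nonneg l₁ (x := x) (y := y) (Or.inr ⟨h1.ge, by
      rw [e1]; exact (mul_pos_of_neg_of_neg (inv_lt_zero.2 hcz) hcx).le⟩),
    eventually_nonneg l₂ (x := x) (y := y) (Or.inl (by rw [e2, h1]; simpa using hay)),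
    eventually_nonneg l₃ (x := x) (y := y) (Or.inl (by rw [e3, h1]; simpa using hby))]
    with ε h1 h2 h3
  set t : Plane := AffineMap.lineMap y x ε with ht
  have hc1 : l₁ t * c z = c t := by
    rw [e1, mul_comm, ← mul_assoc, mul_inv_cancel₀ hcz.ne, one_mul]
  have hsum : l₁ t + l₂ t + l₃ t = 1 := by
    rw [e2, e3]
    linear_combination hB.sum t - l₁ t * hB.sum z + hc1
  have hcomb : l₁ t • z + l₂ t • u + l₃ t • w = t := by
    conv_lhs => rw [show l₁ t • z = l₁ t • (a z • u + b z • w + c z • v) by rw [hB.comb]]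
    conv_rhs => rw [← hB.comb t, ← hc1]
    rw [e2, e3]
    module
  have := hC.sum_mem (t := (Finset.univ : Finset (Fin 3)))
      (w := ![l₁ t, l₂ t, l₃ t]) (z := ![z, u, w]) ?_ ?_ ?_
  · rw [← hcomb]
    simpa [Fin.sum_univ_three] using this
  · intro i _
    fin_cases i
    · exact h1
    · exact h2
    · exact h3
  · simpa [Fin.sum_univ_three] using hsum
  · intro i _
    fin_cases i
    · exact hz
    · exact hu
    · exact hw

/-- Outside the convex hull, if a Delaunay triangle has a hidden vertex, then so does a triangle of
any other triangulation. -/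
theorem IsGeometricTriangulation.exists_hidden_of_delaunay (hK : IsGeometricTriangulation S K)
    (hi : (interior (convexHull ℝ (S : Set Plane))).Nonempty) {x : Plane} {ρ : ℝ}
    (hx : x ∉ convexHull ℝ (S : Set Plane)) {D : Finset Plane} (hD : D ∈ delaunay S)
    {p q r : Plane} {a b c : Plane →ᵃ[ℝ] ℝ} (h : Hidden D x ρ p q r a b c) :
    ∃ T ∈ triangles S K, ∃ p q r a b c, Hidden T x ρ p q r a b c := by
  classical
  have hDS := (mem_delaunay.1 hD).1
  have hC := convex_convexHull ℝ (S : Set Plane)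
  have hSC : ∀ v ∈ S, v ∈ convexHull ℝ (S : Set Plane) := fun v hv =>
    subset_convexHull ℝ _ (Finset.mem_coe.2 hv)
  set γ : ℝ → Plane := fun τ => AffineMap.lineMap x r τ with hγ
  have hγc : Continuous γ := AffineMap.lineMap_continuous
  have hEc : IsCompact (Set.Icc (0 : ℝ) 1 ∩ γ ⁻¹' (convexHull ℝ (S : Set Plane))) :=
    isCompact_Icc.inter_right ((S.finite_toSet.isCompact_convexHull ℝ).isClosed.preimage hγc)
  have hEne : (Set.Icc (0 : ℝ) 1 ∩ γ ⁻¹' (convexHull ℝ (S : Set Plane))).Nonempty :=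
    ⟨1, by simp, by simpa [hγ] using hSC r (hDS h.r_mem)⟩
  -- The point `y` where the segment from `x` to the hidden vertex `r` first enters the convex hull.
  obtain ⟨t, ⟨ht01, htC⟩, htmin⟩ := hEc.exists_isLeast hEne
  set y := γ t with hy
  have hyC : y ∈ convexHull ℝ (S : Set Plane) := htC
  have hyd : dist y x ≤ ρ := dist_lineMap_le h.hr ht01.1 ht01.2
  have hyx : y ≠ x := fun h => hx (h ▸ hyC)
  have ht0 : 0 < t := by
    refine lt_of_le_of_ne ht01.1 fun h0 => hyx ?_
    simp [hy, hγ, ← h0]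
  have hbefore : ∀ ε : ℝ, 0 < ε → ε ≤ 1 →
      (AffineMap.lineMap y x ε : Plane) ∉ convexHull ℝ (S : Set Plane) := by
    intro ε h0 h1 hmem
    have e : (AffineMap.lineMap y x ε : Plane) = γ ((1 - ε) * t) := by
      simp only [hy, hγ, AffineMap.lineMap_apply_module]
      module
    rw [e] at hmem
    have h2 : (1 - ε) * t ∈ Set.Icc (0 : ℝ) 1 :=
      ⟨mul_nonneg (by linarith) ht0.le, by nlinarith [ht01.2]⟩
    have := htmin ⟨h2, hmem⟩
    nlinarith
  have hchord : ∀ z, dist z x ≤ ρ → c z = 0 → z ∈ convexHull ℝ (S : Set Plane) := by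
    intro z hz hcz
    obtain ⟨ha, hb⟩ := h.chord_pos hz hcz
    have : z ∈ convexHull ℝ {p, q} := (h.toBary.mem_segment_iff z).2 ⟨ha.le, hb.le, hcz⟩
    refine convexHull_mono ?_ this
    rintro v (rfl | rfl)
    · exact hDS h.p_mem
    · exact hDS h.q_mem
  -- Otherwise the segment would have crossed the edge `p q`, a part of the hull, before reaching
  -- `y`.
  have hcy : c y ≤ 0 := by
    by_contra! hcy
    obtain ⟨α, β, hα, hβ, hs, he⟩ := exists_crossing c h.cx.le hcy
    have hd := dist_comb_le h.dist_self_le hyd hα.le hβ hs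
    refine hbefore α hα (by linarith) ?_
    have := hchord _ hd he
    rwa [AffineMap.lineMap_apply_module, ← show β = 1 - α by linarith, add_comm]
  have hyS : y ∉ S := fun hyS => absurd (h.pos_of_delaunay hD hyS hyd) (not_lt.2 hcy)
  have hcov := hK.hull_subset hi hyC
  simp only [Set.mem_iUnion, exists_prop] at hcov
  obtain ⟨T, hT, hyT⟩ := hcov
  have hTS := (mem_triangles.1 hT).1
  have hTC : convexHull ℝ (T : Set Plane) ⊆ convexHull ℝ (S : Set Plane) :=
    convexHull_mono (by exact_mod_cast hTS)
  by_cases hfar : ∀ v ∈ T, ρ < dist v x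
  · refine hK.exists_hidden_of_far hi ?_ (hDS h.r_mem) h.hr ht01 hT hfar hyT
    intro T₁ hT₁ T₂ _ _ hx₁
    exact absurd (convexHull_mono (by exact_mod_cast (mem_triangles.1 hT₁).1) hx₁) hx
  have hTt := isTriangle_of_mem_triangles hT
  -- If no edge line of `T` through `y` had `x` strictly on its outer side, a step from `y` towards
  -- `x` would stay in `T`, hence in the hull.
  have hexit : ∃ u w v a' b' c', Bary u w v a' b' c' ∧ (T : Set Plane) = {u, w, v} ∧
      c' y = 0 ∧ c' x < 0 := by
    obtain ⟨v, hv⟩ := hTt.nonempty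
    obtain ⟨u, w, a', b', c', hB, hset⟩ := hTt.exists_bary hv
    obtain ⟨ha, hb, hc⟩ := (hB.mem_hull_iff hset y).1 hyT
    by_contra! hcon
    have hl : ∀ l : Plane →ᵃ[ℝ] ℝ, 0 ≤ l y → (l y = 0 → 0 ≤ l x) →
        0 < l y ∨ (0 ≤ l y ∧ 0 ≤ l x) := by
      intro l h1 h2
      rcases h1.lt_or_eq with h3 | h3
      · exact Or.inl h3
      · exact Or.inr ⟨h1, h2 h3.symm⟩
    have hset1 := Bary.set_rotate hset
    have hset2 := Bary.set_rotate hset1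
    have h1 := eventually_nonneg a' (hl a' ha (hcon _ _ _ _ _ _ hB.rotate hset1))
    have h2 := eventually_nonneg b' (hl b' hb (hcon _ _ _ _ _ _ hB.rotate.rotate hset2))
    have h3 := eventually_nonneg c' (hl c' hc (hcon _ _ _ _ _ _ hB hset))
    obtain ⟨ε, ⟨⟨h1, h2⟩, h3⟩, h4⟩ :=
      (((h1.and h2).and h3).and (Ioo_mem_nhdsGT (zero_lt_one' ℝ))).exists
    exact hbefore ε h4.1 h4.2.le (hTC ((hB.mem_hull_iff hset _).2 ⟨h1, h2, h3⟩))
  obtain ⟨u, w, v, a', b', c', hB, hset, hcy', hcx'⟩ := hexit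
  -- An end `u` of the exit edge within `ρ` lies beyond `p q`, so the segment from `x` to `u`
  -- crosses the edge `p q` at a point `z` of the hull on the outer side of `u w`. The triangle `z u
  -- w` then extends the hull past `y` towards `x`, a contradiction.
  have hnear : ∀ u w a' b', Bary u w v a' b' c' → (T : Set Plane) = {u, w, v} → ρ < dist u x := by
    intro u w a' b' hB hset
    by_contra! hud
    have huS : u ∈ S := hTS (by rw [← Finset.mem_coe, hset]; simp)
    have hwS : w ∈ S := hTS (by rw [← Finset.mem_coe, hset]; simp)
    obtain ⟨ha, hb, -⟩ := (hB.mem_hull_iff hset y).1 hyT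
    have hs := hB.sum y
    have hcomb := hB.comb y
    rw [hcy'] at hs hcomb
    have ha' : 0 < a' y := by
      refine lt_of_le_of_ne ha fun h0 => hyS ?_
      have : b' y = 1 := by linarith
      rw [← h0, this] at hcomb
      simp only [zero_smul, one_smul, zero_add, add_zero] at hcomb
      exact hcomb ▸ hwS
    have hb' : 0 < b' y := by
      refine lt_of_le_of_ne hb fun h0 => hyS ?_
      have : a' y = 1 := by linarith
      rw [← h0, this] at hcomb
      simp only [zero_smul, one_smul, add_zero] at hcomb
      exact hcomb ▸ huS
    have hcu : 0 < c u := h.pos_of_delaunay hD huS hud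
    obtain ⟨α, β, hα, hβ, hs, he⟩ := exists_crossing c h.cx.le hcu
    have hd := dist_comb_le h.dist_self_le hud hα.le hβ hs
    have hz := hchord _ hd he
    have hcz : c' (α • x + β • u) < 0 := by
      rw [affine_comb₂ _ _ _ _ _ hs, hB.cp]
      have := mul_neg_of_pos_of_neg hα hcx'
      linarith
    obtain ⟨ε, h1, h2⟩ := ((hB.eventually_mem hC (hSC u huS) (hSC w hwS) hz hcz hcx' ha' hb'
      hcy').and (Ioo_mem_nhdsGT (zero_lt_one' ℝ))).exists
    exact hbefore ε h2.1 h2.2.le h1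
  have hud := hnear u w a' b' hB hset
  have hwd := hnear w u b' a' hB.swap (Bary.set_swap hset)
  have hvd : dist v x ≤ ρ := by
    by_contra! hcon
    apply hfar
    intro z hz
    rw [← Finset.mem_coe, hset] at hz
    rcases hz with rfl | rfl | rfl <;> assumption
  obtain ⟨ha, hb, -⟩ := (hB.mem_hull_iff hset y).1 hyT
  exact ⟨T, hT, u, w, v, a', b', c',
    hB.hidden_of_edge hset hvd hud hwd hyd ha hb hcy' hcx'⟩

end Complex

/-! ### The pointwise inequality -/

/-- Compare total lengths of a family of disjoint intervals and of a family that covers it. -/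
theorem sum_length_le {ι κ : Type*} (F : Finset ι) (G : Finset κ) (l h : ι → ℝ) (l' h' : κ → ℝ)
    (hle : ∀ i ∈ F, l i ≤ h i) (hle' : ∀ j ∈ G, l' j ≤ h' j)
    (hdisj : ∀ i ∈ F, ∀ j ∈ F, ∀ t, t ∈ Set.Ico (l i) (h i) → t ∈ Set.Ico (l j) (h j) → i = j)
    (hsub : ∀ i ∈ F, ∀ t ∈ Set.Ico (l i) (h i), ∃ j ∈ G, t ∈ Set.Ico (l' j) (h' j)) :
    ∑ i ∈ F, (h i - l i) ≤ ∑ j ∈ G, (h' j - l' j) := by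
  have h1 : volume (⋃ i ∈ F, Set.Ico (l i) (h i)) = ∑ i ∈ F, volume (Set.Ico (l i) (h i)) := by
    apply measure_biUnion_finset
    · intro i hi j hj hij
      rw [Function.onFun, Set.disjoint_left]
      intro t h1 h2
      exact hij (hdisj i hi j hj t h1 h2)
    · intro i _
      exact measurableSet_Ico
  have h2 : volume (⋃ i ∈ F, Set.Ico (l i) (h i)) ≤ volume (⋃ j ∈ G, Set.Ico (l' j) (h' j)) := by
    apply measure_mono
    intro t ht
    simp only [Set.mem_iUnion, exists_prop] at ht ⊢
    obtain ⟨i, hi, ht⟩ := ht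
    exact hsub i hi t ht
  have h3 := measure_biUnion_finset_le (μ := volume) G (fun j => Set.Ico (l' j) (h' j))
  have h4 := (h1.symm.le.trans h2).trans h3
  simp only [Real.volume_Ico] at h4
  rw [← ENNReal.ofReal_sum_of_nonneg fun i hi => sub_nonneg.2 (hle i hi),
    ← ENNReal.ofReal_sum_of_nonneg fun i hi => sub_nonneg.2 (hle' i hi)] at h4
  rwa [ENNReal.ofReal_le_ofReal_iff
    (Finset.sum_nonneg fun i hi => sub_nonneg.2 (hle' i hi))] at h4

/-- Levels are squared distances, so that for `x` outside the triangle the length of this interval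
is `-localTriangle Δ x`. -/
theorem Hidden.mem_Ico {Δ : Finset Plane} {x : Plane} {t : ℝ} (ht : 0 ≤ t) {p q r : Plane}
    {a b c : Plane →ᵃ[ℝ] ℝ} (h : Hidden Δ x (√t) p q r a b c) :
    t ∈ Set.Ico (Metric.infDist x (Δ : Set Plane) ^ 2)
      (Metric.infDist x (visibleVertices Δ x) ^ 2) :=
  ⟨(Real.le_sqrt Metric.infDist_nonneg ht).1 h.infDist_le,
    (Real.sqrt_lt ht Metric.infDist_nonneg).1 h.lt_infDist⟩

theorem IsTriangle.exists_hidden_of_mem_Ico {Δ : Finset Plane} (hΔ : IsTriangle Δ) {x : Plane}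
    (hx : x ∉ convexHull ℝ (Δ : Set Plane)) {t : ℝ}
    (ht : t ∈ Set.Ico (Metric.infDist x (Δ : Set Plane) ^ 2)
      (Metric.infDist x (visibleVertices Δ x) ^ 2)) :
    0 ≤ t ∧ ∃ p q r a b c, Hidden Δ x (√t) p q r a b c := by
  have ht0 : 0 ≤ t := (sq_nonneg _).trans ht.1
  exact ⟨ht0, hΔ.exists_hidden hx ((Real.le_sqrt Metric.infDist_nonneg ht0).2 ht.1)
    ((Real.sqrt_lt ht0 Metric.infDist_nonneg).2 ht.2)⟩

theorem IsTriangle.sq_infDist_le {Δ : Finset Plane} (hΔ : IsTriangle Δ) {x : Plane}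
    (hx : x ∉ convexHull ℝ (Δ : Set Plane)) :
    Metric.infDist x (Δ : Set Plane) ^ 2 ≤ Metric.infDist x (visibleVertices Δ x) ^ 2 :=
  pow_le_pow_left₀ Metric.infDist_nonneg (hΔ.infDist_le_visible hx) 2

section

variable {S : Finset Plane} {K : Geometry.SimplicialComplex ℝ Plane} {x : Plane}

open Classical in
theorem localVoronoi_eq (F : Finset (Finset Plane)) (x : Plane) :
    localVoronoi F x =
      ∑ T ∈ Finset.filter (fun T : Finset Plane => x ∈ convexHull ℝ (T : Set Plane)) F, Metric.infDist x (T : Set Plane) ^ 2 -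
      ∑ T ∈ Finset.filter (fun T : Finset Plane => x ∉ convexHull ℝ (T : Set Plane)) F,
        (Metric.infDist x (visibleVertices T x) ^ 2 - Metric.infDist x (T : Set Plane) ^ 2) := by
  unfold localVoronoi
  rw [← Finset.sum_filter_add_sum_filter_not F (fun T : Finset Plane => x ∈ convexHull ℝ (T : Set Plane)),
    sub_eq_add_neg, ← Finset.sum_neg_distrib]
  congr 1
  · exact Finset.sum_congr rfl fun T hT =>
      localTriangle_of_mem_hull (Finset.mem_filter.1 hT).2
  · refine Finset.sum_congr rfl fun T _ => ?_
    unfold localTriangle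
    ring

theorem delaunay_disjoint (hS : GeneralPosition S) :
    ∀ T ∈ delaunay S, ∀ T' ∈ delaunay S, x ∉ convexHull ℝ (T : Set Plane) →
      x ∉ convexHull ℝ (T' : Set Plane) → ∀ t,
      t ∈ Set.Ico (Metric.infDist x (T : Set Plane) ^ 2)
        (Metric.infDist x (visibleVertices T x) ^ 2) →
      t ∈ Set.Ico (Metric.infDist x (T' : Set Plane) ^ 2)
        (Metric.infDist x (visibleVertices T' x) ^ 2) → T = T' := by
  intro T hT T' hT' hx hx' t ht ht'
  obtain ⟨-, _, _, _, _, _, _, h⟩ :=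
    (mem_delaunay.1 hT).2.1.exists_hidden_of_mem_Ico hx ht
  obtain ⟨-, _, _, _, _, _, _, h'⟩ :=
    (mem_delaunay.1 hT').2.1.exists_hidden_of_mem_Ico hx' ht'
  exact h'.unique hS hT' h hT

/-- Outside the hull both sides are negated total lengths. The Delaunay intervals are disjoint by
`Hidden.unique` and covered by those of `K` by `exists_hidden_of_delaunay`. -/
theorem localVoronoi_le_of_notMem (hS : GeneralPosition S) (hK : IsGeometricTriangulation S K)
    (hi : (interior (convexHull ℝ (S : Set Plane))).Nonempty)
    (hx : x ∉ convexHull ℝ (S : Set Plane)) :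
    localVoronoi (triangles S K) x ≤ localVoronoi (delaunay S) x := by
  classical
  have hnot : ∀ T : Finset Plane, T ⊆ S → x ∉ convexHull ℝ (T : Set Plane) := fun T hT h =>
    hx (convexHull_mono (by exact_mod_cast hT) h)
  have h1 : ∀ F : Finset (Finset Plane), localVoronoi F x =
      -∑ T ∈ F, (Metric.infDist x (visibleVertices T x) ^ 2 -
        Metric.infDist x (T : Set Plane) ^ 2) := by
    intro F
    unfold localVoronoi
    rw [← Finset.sum_neg_distrib]
    refine Finset.sum_congr rfl fun T _ => ?_
    unfold localTriangle
    ring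
  have hDS : ∀ T ∈ delaunay S, T ⊆ S := fun T hT => (mem_delaunay.1 hT).1
  have hKS : ∀ T ∈ triangles S K, T ⊆ S := fun T hT => (mem_triangles.1 hT).1
  rw [h1, h1, neg_le_neg_iff]
  apply sum_length_le
  · exact fun T hT => (mem_delaunay.1 hT).2.1.sq_infDist_le (hnot T (hDS T hT))
  · exact fun T hT => (isTriangle_of_mem_triangles hT).sq_infDist_le (hnot T (hKS T hT))
  · exact fun T hT T' hT' => delaunay_disjoint hS T hT T' hT' (hnot T (hDS T hT))
      (hnot T' (hDS T' hT'))
  · intro T hT t ht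
    obtain ⟨ht0, _, _, _, _, _, _, h⟩ :=
      (mem_delaunay.1 hT).2.1.exists_hidden_of_mem_Ico (hnot T (hDS T hT)) ht
    obtain ⟨T', hT', _, _, _, _, _, _, h'⟩ := hK.exists_hidden_of_delaunay hi hx hT h
    exact ⟨T', hT', h'.mem_Ico ht0⟩

/-- At most one triangle `T₀` contains `x`. At every level between the squared distances from `x` to
`S` and to `T₀`, some point of `S` is close and all vertices of `T₀` are far, so
`exists_hidden_of_far`, started at `x` itself, gives an interval of `K` with this level. The
negative terms thus compensate the excess of the term of `T₀`. -/
theorem localVoronoi_triangles_le (hK : IsGeometricTriangulation S K)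
    (hi : (interior (convexHull ℝ (S : Set Plane))).Nonempty)
    (hx : ∀ T ∈ triangles S K, ∀ T' ∈ triangles S K, T ≠ T' →
      x ∈ convexHull ℝ (T : Set Plane) → x ∉ convexHull ℝ (T' : Set Plane)) :
    localVoronoi (triangles S K) x ≤ Metric.infDist x (S : Set Plane) ^ 2 := by
  classical
  rw [localVoronoi_eq]
  have hle : ∀ T ∈ (triangles S K).filter (fun T : Finset Plane => x ∉ convexHull ℝ (T : Set Plane)),
      Metric.infDist x (T : Set Plane) ^ 2 ≤ Metric.infDist x (visibleVertices T x) ^ 2 :=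
    fun T hT => (isTriangle_of_mem_triangles (Finset.mem_filter.1 hT).1).sq_infDist_le
      (Finset.mem_filter.1 hT).2
  by_cases hex : ∃ T₀ ∈ triangles S K, x ∈ convexHull ℝ (T₀ : Set Plane)
  · obtain ⟨T₀, hT₀, hxT₀⟩ := hex
    have hT₀t := isTriangle_of_mem_triangles hT₀
    have hT₀S := (mem_triangles.1 hT₀).1
    have hfil : (triangles S K).filter (fun T : Finset Plane => x ∈ convexHull ℝ (T : Set Plane)) = {T₀} := by
      ext T
      simp only [Finset.mem_filter, Finset.mem_singleton]
      constructor
      · rintro ⟨hT, hxT⟩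
        by_contra hne
        exact hx T hT T₀ hT₀ hne hxT hxT₀
      · rintro rfl
        exact ⟨hT₀, hxT₀⟩
    have hSne : S.Nonempty := hT₀t.nonempty.mono hT₀S
    have hm : Metric.infDist x (S : Set Plane) ≤ Metric.infDist x (T₀ : Set Plane) :=
      Metric.infDist_le_infDist_of_subset (by exact_mod_cast hT₀S) (by simpa using hT₀t.nonempty)
    rw [hfil, Finset.sum_singleton]
    have := sum_length_le (Finset.univ : Finset Unit)
      ((triangles S K).filter (fun T : Finset Plane => x ∉ convexHull ℝ (T : Set Plane)))
      (fun _ => Metric.infDist x (S : Set Plane) ^ 2)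
      (fun _ => Metric.infDist x (T₀ : Set Plane) ^ 2)
      (fun T => Metric.infDist x (T : Set Plane) ^ 2)
      (fun T => Metric.infDist x (visibleVertices T x) ^ 2)
      (fun _ _ => pow_le_pow_left₀ Metric.infDist_nonneg hm 2) hle (fun _ _ _ _ _ _ _ => rfl) ?_
    · simp only [Finset.univ_unique, Finset.sum_singleton] at this
      linarith
    · intro _ _ t ht
      have ht0 : 0 ≤ t := (sq_nonneg _).trans ht.1
      obtain ⟨s, hs, hsd⟩ := (infDist_le_iff hSne x (√t)).1
        ((Real.le_sqrt Metric.infDist_nonneg ht0).2 ht.1)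
      have hlt := (Real.sqrt_lt ht0 Metric.infDist_nonneg).2 ht.2
      have hfar : ∀ v ∈ T₀, √t < dist v x := by
        intro v hv
        by_contra! hcon
        exact absurd ((infDist_le_iff hT₀t.nonempty x (√t)).2 ⟨v, hv, hcon⟩) (not_le.2 hlt)
      obtain ⟨T, hT, _, _, _, _, _, _, h⟩ := hK.exists_hidden_of_far hi hx hs hsd
        (τ₀ := 0) (by simp) hT₀ hfar (by simpa using hxT₀)
      exact ⟨T, Finset.mem_filter.2 ⟨hT, h.notMem_hull⟩, h.mem_Ico ht0⟩
  · push Not at hex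
    rw [Finset.filter_false_of_mem hex, Finset.sum_empty]
    have := Finset.sum_nonneg fun T hT => sub_nonneg.2 (hle T hT)
    have := sq_nonneg (Metric.infDist x (S : Set Plane))
    linarith

/-- The disjoint Delaunay intervals fit between the squared distances from `x` to `S` and to a
Delaunay triangle containing `x`; the upper end comes from `Hidden.lt_dist_of_mem_hull`. Further
triangles containing `x` only add nonnegative terms. -/
theorem le_localVoronoi_delaunay (hS : GeneralPosition S)
    (hi : (interior (convexHull ℝ (S : Set Plane))).Nonempty)
    (hx : x ∈ convexHull ℝ (S : Set Plane)) :
    Metric.infDist x (S : Set Plane) ^ 2 ≤ localVoronoi (delaunay S) x := by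
  classical
  have hcov := hull_subset_delaunay hi hx
  simp only [Set.mem_iUnion, exists_prop] at hcov
  obtain ⟨T₀, hT₀, hxT₀⟩ := hcov
  obtain ⟨hT₀S, hT₀t, -⟩ := mem_delaunay.1 hT₀
  have hm : Metric.infDist x (S : Set Plane) ≤ Metric.infDist x (T₀ : Set Plane) :=
    Metric.infDist_le_infDist_of_subset (by exact_mod_cast hT₀S) (by simpa using hT₀t.nonempty)
  have hSne : S.Nonempty := hT₀t.nonempty.mono hT₀S
  rw [localVoronoi_eq]
  have h1 : Metric.infDist x (T₀ : Set Plane) ^ 2 ≤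
      ∑ T ∈ Finset.filter (fun T : Finset Plane => x ∈ convexHull ℝ (T : Set Plane)) (delaunay S),
        Metric.infDist x (T : Set Plane) ^ 2 :=
    Finset.single_le_sum (f := fun T : Finset Plane => Metric.infDist x (T : Set Plane) ^ 2)
      (fun _ _ => sq_nonneg _) (Finset.mem_filter.2 ⟨hT₀, hxT₀⟩)
  have := sum_length_le
    ((delaunay S).filter (fun T : Finset Plane => x ∉ convexHull ℝ (T : Set Plane)))
    (Finset.univ : Finset Unit)
    (fun T => Metric.infDist x (T : Set Plane) ^ 2)
    (fun T => Metric.infDist x (visibleVertices T x) ^ 2)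
    (fun _ => Metric.infDist x (S : Set Plane) ^ 2)
    (fun _ => Metric.infDist x (T₀ : Set Plane) ^ 2)
    (fun T hT => (mem_delaunay.1 (Finset.mem_filter.1 hT).1).2.1.sq_infDist_le
      (Finset.mem_filter.1 hT).2)
    (fun _ _ => pow_le_pow_left₀ Metric.infDist_nonneg hm 2)
    (fun T hT T' hT' => delaunay_disjoint hS T (Finset.mem_filter.1 hT).1 T'
      (Finset.mem_filter.1 hT').1 (Finset.mem_filter.1 hT).2 (Finset.mem_filter.1 hT').2) ?_
  · simp only [Finset.univ_unique, Finset.sum_singleton] at this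
    linarith
  · intro T hT t ht
    obtain ⟨hTD, hxT⟩ := Finset.mem_filter.1 hT
    obtain ⟨ht0, _, _, r, _, _, _, h⟩ :=
      (mem_delaunay.1 hTD).2.1.exists_hidden_of_mem_Ico hxT ht
    refine ⟨(), by simp, ?_, ?_⟩
    · rw [← Real.le_sqrt Metric.infDist_nonneg ht0, infDist_le_iff hSne]
      exact ⟨r, (mem_delaunay.1 hTD).1 h.r_mem, h.hr⟩
    · rw [← Real.sqrt_lt ht0 Metric.infDist_nonneg]
      by_contra! hcon
      obtain ⟨v, hv, hvd⟩ := (infDist_le_iff hT₀t.nonempty x _).1 hcon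
      exact absurd (h.lt_dist_of_mem_hull hS hTD hT₀ hxT₀ hv) (not_lt.2 hvd)

theorem localVoronoi_triangles_le_of_mem (hK : IsGeometricTriangulation S K) (hx : x ∈ S) :
    localVoronoi (triangles S K) x ≤ 0 := by
  apply Finset.sum_nonpos
  intro T hT
  by_cases hxT : x ∈ convexHull ℝ (T : Set Plane)
  · exact (localTriangle_of_mem (hK.mem_of_mem_hull hT hx hxT)).le
  · exact (isTriangle_of_mem_triangles hT).local_nonpos hxT

theorem triangle_interior_nonempty {T : Finset Plane} (hT : IsTriangle T) (hTS : T ⊆ S) :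
    (interior (convexHull ℝ (S : Set Plane))).Nonempty := by
  have h1 : affineSpan ℝ (T : Set Plane) = ⊤ := by
    have := hT.2.affineSpan_eq_top_iff_card_eq_finrank_add_one (k := ℝ)
    rw [Subtype.range_coe_subtype] at this
    simp only [Finset.setOfPred_mem] at this
    rw [this]
    simp [hT.1]
  have h2 := interior_convexHull_nonempty_iff_affineSpan_eq_top.2 h1
  exact h2.mono (interior_mono (convexHull_mono (by exact_mod_cast hTS)))

/-- Inside the hull the bound passes through the squared distance to `S`. At a point of `S` several
triangles of `K` may meet, but each has `x` as a vertex and contributes `0`. If the hull has no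
interior, there are no triangles at all. -/
theorem localVoronoi_le (hS : GeneralPosition S) (hK : IsGeometricTriangulation S K)
    (hx : ∀ T ∈ triangles S K, ∀ T' ∈ triangles S K, T ≠ T' →
      x ∈ convexHull ℝ (T : Set Plane) → x ∈ convexHull ℝ (T' : Set Plane) → x ∈ S) :
    localVoronoi (triangles S K) x ≤ localVoronoi (delaunay S) x := by
  by_cases hi : (interior (convexHull ℝ (S : Set Plane))).Nonempty
  · by_cases hxS : x ∈ convexHull ℝ (S : Set Plane)
    · refine le_trans ?_ (le_localVoronoi_delaunay hS hi hxS)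
      by_cases hxm : x ∈ S
      · exact (localVoronoi_triangles_le_of_mem hK hxm).trans (sq_nonneg _)
      · exact localVoronoi_triangles_le hK hi fun T hT T' hT' hne h1 h2 =>
          hxm (hx T hT T' hT' hne h1 h2)
    · exact localVoronoi_le_of_notMem hS hK hi hxS
  · have h1 : triangles S K = ∅ := Finset.eq_empty_of_forall_notMem fun T hT =>
      hi (triangle_interior_nonempty (isTriangle_of_mem_triangles hT) (mem_triangles.1 hT).1)
    have h2 : delaunay S = ∅ := Finset.eq_empty_of_forall_notMem fun T hT =>
      hi (triangle_interior_nonempty (mem_delaunay.1 hT).2.1 (mem_delaunay.1 hT).1)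
    rw [h1, h2]

end

/-! ### The integral for a non-acute triangle in affine coordinates -/

/-- The standard triangle in the coordinate plane. -/
def stdTriangle : Set (ℝ × ℝ) := {z | 0 ≤ z.1 ∧ 0 ≤ z.2 ∧ z.1 + z.2 ≤ 1}

theorem isClosed_stdTriangle : IsClosed stdTriangle := by
  have h1 : IsClosed {z : ℝ × ℝ | 0 ≤ z.1} := isClosed_le continuous_const continuous_fst
  have h2 : IsClosed {z : ℝ × ℝ | 0 ≤ z.2} := isClosed_le continuous_const continuous_snd
  have h3 : IsClosed {z : ℝ × ℝ | z.1 + z.2 ≤ 1} := isClosed_le (by fun_prop) continuous_const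
  exact h1.inter (h2.inter h3)

theorem isCompact_stdTriangle : IsCompact stdTriangle := by
  refine IsCompact.of_isClosed_subset (isCompact_Icc (a := ((0, 0) : ℝ × ℝ)) (b := (1, 1)))
    isClosed_stdTriangle ?_
  rintro ⟨s, t⟩ ⟨h1, h2, h3⟩
  simp only at h1 h2 h3
  exact ⟨⟨h1, h2⟩, ⟨by simp only; linarith, by simp only; linarith⟩⟩

theorem integral_cubic (c₀ c₁ c₂ c₃ u : ℝ) :
    ∫ t in (0 : ℝ)..u, (c₀ + c₁ * t + c₂ * t ^ 2 + c₃ * t ^ 3) =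
      c₀ * u + c₁ * u ^ 2 / 2 + c₂ * u ^ 3 / 3 + c₃ * u ^ 4 / 4 := by
  have hc : Continuous fun t : ℝ => c₀ + c₁ * t + c₂ * t ^ 2 + c₃ * t ^ 3 := by fun_prop
  have hd : ∀ t : ℝ, HasDerivAt
      (fun t : ℝ => c₀ * t + c₁ * t ^ 2 / 2 + c₂ * t ^ 3 / 3 + c₃ * t ^ 4 / 4)
      (c₀ + c₁ * t + c₂ * t ^ 2 + c₃ * t ^ 3) t := by
    intro t
    have h1 := (hasDerivAt_id t).const_mul c₀
    have h2 := ((hasDerivAt_pow 2 t).const_mul c₁).div_const 2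
    have h3 := ((hasDerivAt_pow 3 t).const_mul c₂).div_const 3
    have h4 := ((hasDerivAt_pow 4 t).const_mul c₃).div_const 4
    refine (((h1.add h2).add h3).add h4).congr_deriv ?_
    push_cast
    simp only [pow_one]
    norm_num
    ring
  rw [intervalIntegral.integral_eq_sub_of_hasDerivAt (fun t _ => hd t)
    (hc.intervalIntegrable _ _)]
  ring

theorem integral_stdTriangle (k₀ k₁ k₂ k₃ k₄ k₅ : ℝ) :
    ∫ z in stdTriangle, (k₀ + k₁ * z.1 + k₂ * z.2 + k₃ * z.1 ^ 2 + k₄ * (z.1 * z.2) +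
      k₅ * z.2 ^ 2) = k₀ / 2 + k₁ / 6 + k₂ / 6 + k₃ / 12 + k₄ / 24 + k₅ / 12 := by
  set F : ℝ × ℝ → ℝ := fun z => k₀ + k₁ * z.1 + k₂ * z.2 + k₃ * z.1 ^ 2 + k₄ * (z.1 * z.2) +
      k₅ * z.2 ^ 2 with hF
  have hFc : Continuous F := by fun_prop
  have hm : MeasurableSet stdTriangle := isClosed_stdTriangle.measurableSet
  have hint : Integrable (stdTriangle.indicator F) (volume.prod volume) :=
    (integrable_indicator_iff hm).2 (hFc.continuousOn.integrableOn_compact isCompact_stdTriangle)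
  rw [← integral_indicator hm, Measure.volume_eq_prod, integral_prod _ hint]
  have hinner : ∀ s : ℝ, ∫ t, stdTriangle.indicator F (s, t) =
      (Set.Icc (0 : ℝ) 1).indicator (fun s => (k₀ + k₂ / 2 + k₅ / 3) +
        (-k₀ + k₁ - k₂ + k₄ / 2 - k₅) * s + (-k₁ + k₂ / 2 + k₃ - k₄ + k₅) * s ^ 2 +
        (-k₃ + k₄ / 2 - k₅ / 3) * s ^ 3) s := by
    intro s
    by_cases hs : s ∈ Set.Icc (0 : ℝ) 1
    · rw [Set.indicator_of_mem hs]
      have e : (fun t => stdTriangle.indicator F (s, t)) =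
          (Set.Icc 0 (1 - s)).indicator (fun t => F (s, t)) := by
        funext t
        by_cases ht : t ∈ Set.Icc 0 (1 - s)
        · rw [Set.indicator_of_mem ht, Set.indicator_of_mem]
          exact ⟨hs.1, ht.1, by simp only; linarith [ht.2]⟩
        · rw [Set.indicator_of_notMem ht, Set.indicator_of_notMem]
          rintro ⟨_, h2, h3⟩
          exact ht ⟨h2, by simp only at h3; linarith⟩
      rw [e, integral_indicator measurableSet_Icc, integral_Icc_eq_integral_Ioc,
        ← intervalIntegral.integral_of_le (by linarith [hs.2])]
      have e2 : (fun t => F (s, t)) = fun t => (k₀ + k₁ * s + k₃ * s ^ 2) + (k₂ + k₄ * s) * t +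
          k₅ * t ^ 2 + 0 * t ^ 3 := by
        funext t
        simp only [hF]
        ring
      rw [e2, integral_cubic]
      ring
    · rw [Set.indicator_of_notMem hs]
      have e : (fun t => stdTriangle.indicator F (s, t)) = fun _ => 0 := by
        funext t
        rw [Set.indicator_of_notMem]
        rintro ⟨h1, h2, h3⟩
        simp only at h1 h2 h3
        exact hs ⟨h1, by linarith⟩
      rw [e, integral_zero]
  simp only [hinner]
  rw [integral_indicator measurableSet_Icc, integral_Icc_eq_integral_Ioc,
    ← intervalIntegral.integral_of_le zero_le_one, integral_cubic]
  ring

/-- The integral of an affine function over a triangle in the coordinate plane. The triangle is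
given by barycentric coordinates `s` and `t`. -/
theorem integral_triangle {X Y Z : ℝ × ℝ} {D : ℝ}
    (hDe : D = (Y.1 - X.1) * (Z.2 - X.2) - (Z.1 - X.1) * (Y.2 - X.2)) (hD : D ≠ 0)
    {s t : ℝ × ℝ → ℝ}
    (h1 : ∀ z, z.1 = X.1 + s z * (Y.1 - X.1) + t z * (Z.1 - X.1))
    (h2 : ∀ z, z.2 = X.2 + s z * (Y.2 - X.2) + t z * (Z.2 - X.2)) {T : Set (ℝ × ℝ)}
    (hT : ∀ z, z ∈ T ↔ 0 ≤ s z ∧ 0 ≤ t z ∧ s z + t z ≤ 1) (k₀ k₁ k₂ : ℝ) :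
    MeasurableSet T ∧ IntegrableOn (fun z : ℝ × ℝ => k₀ + k₁ * z.1 + k₂ * z.2) T ∧
    ∫ z in T, (k₀ + k₁ * z.1 + k₂ * z.2) =
      |D| / 6 * ((k₀ + k₁ * X.1 + k₂ * X.2) + (k₀ + k₁ * Y.1 + k₂ * Y.2) +
        (k₀ + k₁ * Z.1 + k₂ * Z.2)) := by
  set L : (ℝ × ℝ) →L[ℝ] (ℝ × ℝ) := LinearMap.toContinuousLinearMap
    (Matrix.toLin (Module.Basis.finTwoProd ℝ) (Module.Basis.finTwoProd ℝ)
      !![Y.1 - X.1, Z.1 - X.1; Y.2 - X.2, Z.2 - X.2]) with hL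
  have hLapp : ∀ w : ℝ × ℝ, L w = (w.1 * (Y.1 - X.1) + w.2 * (Z.1 - X.1),
      w.1 * (Y.2 - X.2) + w.2 * (Z.2 - X.2)) := by
    intro w
    rw [hL, Matrix.toLin_finTwoProd_toContinuousLinearMap]
    simp [mul_comm]
  have hdet : L.det = D := by
    rw [hL, ContinuousLinearMap.det, LinearMap.coe_toContinuousLinearMap, LinearMap.det_toLin,
      Matrix.det_fin_two_of, hDe]
  set ψ : ℝ × ℝ → ℝ × ℝ := fun w => X + L w with hψ
  have hψc : Continuous ψ := by fun_prop
  have hinj : ∀ w w', ψ w = ψ w' → w = w' := by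
    intro w w' h
    simp only [hψ, hLapp, Prod.ext_iff, Prod.fst_add, Prod.snd_add] at h
    obtain ⟨e1, e2⟩ := h
    have f1 : D * (w.1 - w'.1) = 0 := by
      rw [hDe]
      linear_combination (Z.2 - X.2) * e1 - (Z.1 - X.1) * e2
    have f2 : D * (w.2 - w'.2) = 0 := by
      rw [hDe]
      linear_combination (Y.1 - X.1) * e2 - (Y.2 - X.2) * e1
    ext
    · linarith [(mul_eq_zero.1 f1).resolve_left hD]
    · linarith [(mul_eq_zero.1 f2).resolve_left hD]
  have hz : ∀ z, ψ (s z, t z) = z := by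
    intro z
    ext
    · simp only [hψ, hLapp, Prod.fst_add]
      linarith [h1 z]
    · simp only [hψ, hLapp, Prod.snd_add]
      linarith [h2 z]
  have himg : T = ψ '' stdTriangle := by
    ext z
    rw [hT]
    constructor
    · intro h
      exact ⟨(s z, t z), h, hz z⟩
    · rintro ⟨w, hw, rfl⟩
      have := hinj _ _ (hz (ψ w))
      rw [← this] at hw
      exact hw
  have hTc : IsCompact T := by
    rw [himg]
    exact isCompact_stdTriangle.image hψc
  have hlc : Continuous fun z : ℝ × ℝ => k₀ + k₁ * z.1 + k₂ * z.2 := by fun_prop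
  refine ⟨hTc.isClosed.measurableSet, hlc.continuousOn.integrableOn_compact hTc, ?_⟩
  rw [himg, integral_image_eq_integral_abs_det_fderiv_smul volume
    isClosed_stdTriangle.measurableSet (f' := fun _ => L)
    (fun w _ => (L.hasFDerivAt.const_add X).hasFDerivWithinAt) (fun w _ w' _ h => hinj w w' h)]
  have e : (fun w : ℝ × ℝ => |L.det| • (k₀ + k₁ * (ψ w).1 + k₂ * (ψ w).2)) = fun w =>
      (|D| * (k₀ + k₁ * X.1 + k₂ * X.2)) +
      (|D| * (k₁ * (Y.1 - X.1) + k₂ * (Y.2 - X.2))) * w.1 +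
      (|D| * (k₁ * (Z.1 - X.1) + k₂ * (Z.2 - X.2))) * w.2 + 0 * w.1 ^ 2 + 0 * (w.1 * w.2) +
      0 * w.2 ^ 2 := by
    funext w
    rw [hdet]
    simp only [hψ, hLapp, Prod.fst_add, Prod.snd_add, smul_eq_mul]
    ring
  rw [e, integral_stdTriangle]
  ring

/-- The squared distance to the vertex `r` in the affine coordinates `y = r + z.1 • (p - r) +
z.2 • (q - r)`, where `A`, `B`, `G` are the entries of the Gram matrix of `p - r` and `q - r`. -/
def gramForm (A B G : ℝ) (z : ℝ × ℝ) : ℝ := A * z.1 ^ 2 + 2 * G * (z.1 * z.2) + B * z.2 ^ 2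

/-- The excess of the squared distance to `p` over the squared distance to `r`. -/
def excessLeft (A G : ℝ) (z : ℝ × ℝ) : ℝ := A - 2 * (A * z.1 + G * z.2)

/-- The excess of the squared distance to `q` over the squared distance to `r`. -/
def excessRight (B G : ℝ) (z : ℝ × ℝ) : ℝ := B - 2 * (G * z.1 + B * z.2)

/-- The part of the cone at `r` in which `r` is the nearest vertex. -/
def nearRegion (A B G : ℝ) : Set (ℝ × ℝ) :=
  {z | 0 ≤ z.1 ∧ 0 ≤ z.2 ∧ 0 ≤ excessLeft A G z ∧ 0 ≤ excessRight B G z}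

/-- The local Voronoi functional of a triangle that is not acute, in affine coordinates. -/
def modelLocal (A B G : ℝ) (z : ℝ × ℝ) : ℝ :=
  stdTriangle.indicator
    (fun z => gramForm A B G z + min (excessLeft A G z) (excessRight B G z)) z -
  (nearRegion A B G).indicator (fun z => min (excessLeft A G z) (excessRight B G z)) z

theorem volume_line_through_zero {u v : ℝ} (hv : v ≠ 0) :
    volume {z : ℝ × ℝ | z.1 * v - z.2 * u = 0} = 0 := by
  set f : (ℝ × ℝ) →ₗ[ℝ] ℝ := v • LinearMap.fst ℝ ℝ ℝ - u • LinearMap.snd ℝ ℝ ℝ with hf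
  have h := Measure.addHaar_submodule (volume : Measure (ℝ × ℝ)) (LinearMap.ker f) ?_
  · convert h using 2
    ext z
    simp [hf, mul_comm]
  · intro htop
    have : ((1 : ℝ), (0 : ℝ)) ∈ LinearMap.ker f := by rw [htop]; trivial
    simp [hf, hv] at this

section

variable {A B G : ℝ}

/-- Minima are removed by `min l m = l - max (l - m) 0`. The region nearest to `r` is a
quadrilateral with corners `r`, the midpoints of the two sides and the circumcenter; the line
through `r` and the circumcenter, excluded by `hz`, cuts it into two triangles. Thus every region on
the right is a triangle. `A ≤ B` ensures that the regions with `l ≥ m` need no separate condition on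
`z.2`. -/
theorem model_identity (hA : 0 < A) (hAB : A ≤ B) (hG : G ≤ 0) {z : ℝ × ℝ}
    (hz : z.1 * (A * (B - G)) - z.2 * (B * (A - G)) ≠ 0) :
    modelLocal A B G z =
      stdTriangle.indicator (fun z => gramForm A B G z + excessLeft A G z) z -
      {z | 0 ≤ z.1 ∧ z.1 + z.2 ≤ 1 ∧ 0 ≤ excessLeft A G z - excessRight B G z}.indicator
        (fun z => excessLeft A G z - excessRight B G z) z -
      {z | 0 ≤ z.2 ∧ 0 ≤ excessLeft A G z ∧
        0 ≤ z.1 * (A * (B - G)) - z.2 * (B * (A - G))}.indicator (excessLeft A G) z -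
      {z | 0 ≤ z.1 ∧ 0 ≤ excessRight B G z ∧
        z.1 * (A * (B - G)) - z.2 * (B * (A - G)) ≤ 0}.indicator (excessLeft A G) z +
      {z | 0 ≤ z.1 ∧ 0 ≤ excessRight B G z ∧
        0 ≤ excessLeft A G z - excessRight B G z}.indicator
        (fun z => excessLeft A G z - excessRight B G z) z := by
  have hB : 0 < B := hA.trans_le hAB
  have hAG : 0 < A - G := by linarith
  have hBG : 0 < B - G := by linarith
  have hu : 0 < B * (A - G) := by positivity
  have hv : 0 < A * (B - G) := by positivity
  -- On either side of the line through `r` and the circumcenter, one of the two bisector conditions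
  -- implies the other.
  have key : A * excessRight B G z =
      B * excessLeft A G z + 2 * (z.1 * (A * (B - G)) - z.2 * (B * (A - G))) := by
    simp only [excessLeft, excessRight]
    ring
  have key2 : 0 ≤ z.1 → 0 ≤ excessLeft A G z - excessRight B G z → 0 ≤ z.2 := by
    intro h1 h2
    have e : excessLeft A G z - excessRight B G z =
        (A - B) - 2 * ((A - G) * z.1) + 2 * ((B - G) * z.2) := by
      simp only [excessLeft, excessRight]
      ring
    have := mul_nonneg hAG.le h1
    have h3 : 0 ≤ (B - G) * z.2 := by linarith
    exact nonneg_of_mul_nonneg_right h3 hBG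
  set σ := z.1 * (A * (B - G)) - z.2 * (B * (A - G)) with hσ
  have key3 : 0 ≤ z.2 → 0 ≤ σ → 0 ≤ z.1 := by
    intro h1 h2
    have := mul_nonneg h1 hu.le
    have h3 : 0 ≤ (A * (B - G)) * z.1 := by linarith
    exact nonneg_of_mul_nonneg_right h3 hv
  have key4 : 0 ≤ z.1 → σ ≤ 0 → 0 ≤ z.2 := by
    intro h1 h2
    have := mul_nonneg h1 hv.le
    have h3 : 0 ≤ (B * (A - G)) * z.2 := by linarith
    exact nonneg_of_mul_nonneg_right h3 hu
  have key5 : 0 ≤ excessLeft A G z → 0 ≤ σ → 0 ≤ excessRight B G z := by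
    intro h1 h2
    have := mul_nonneg hB.le h1
    exact nonneg_of_mul_nonneg_right (by linarith : 0 ≤ A * excessRight B G z) hA
  have key6 : 0 ≤ excessRight B G z → σ ≤ 0 → 0 ≤ excessLeft A G z := by
    intro h1 h2
    have := mul_nonneg hA.le h1
    exact nonneg_of_mul_nonneg_right (by linarith : 0 ≤ B * excessLeft A G z) hB
  have ite : ∀ (T : Set (ℝ × ℝ)) (f : ℝ × ℝ → ℝ) (P : Prop) [Decidable P], (z ∈ T ↔ P) →
      T.indicator f z = if P then f z else 0 := by
    intro T f P _ h
    by_cases hP : P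
    · rw [if_pos hP, Set.indicator_of_mem (h.2 hP)]
    · rw [if_neg hP, Set.indicator_of_notMem (fun h' => hP (h.1 h'))]
  rw [modelLocal, ite stdTriangle _ (0 ≤ z.1 ∧ 0 ≤ z.2 ∧ z.1 + z.2 ≤ 1) Iff.rfl,
    ite stdTriangle _ (0 ≤ z.1 ∧ 0 ≤ z.2 ∧ z.1 + z.2 ≤ 1) Iff.rfl,
    ite (nearRegion A B G) _
      (0 ≤ z.1 ∧ 0 ≤ z.2 ∧ 0 ≤ excessLeft A G z ∧ 0 ≤ excessRight B G z) Iff.rfl,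
    ite _ _ (0 ≤ z.1 ∧ z.1 + z.2 ≤ 1 ∧ 0 ≤ excessLeft A G z - excessRight B G z) Iff.rfl,
    ite _ _ (0 ≤ z.2 ∧ 0 ≤ excessLeft A G z ∧ 0 ≤ σ) Iff.rfl,
    ite _ _ (0 ≤ z.1 ∧ 0 ≤ excessRight B G z ∧ σ ≤ 0) Iff.rfl,
    ite _ _ (0 ≤ z.1 ∧ 0 ≤ excessRight B G z ∧ 0 ≤ excessLeft A G z - excessRight B G z) Iff.rfl]
  generalize excessLeft A G z = l at *
  generalize excessRight B G z = m at *
  generalize gramForm A B G z = f at *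
  clear key
  have h1 : (if 0 ≤ z.1 ∧ 0 ≤ z.2 ∧ z.1 + z.2 ≤ 1 then f + min l m else 0) =
      (if 0 ≤ z.1 ∧ 0 ≤ z.2 ∧ z.1 + z.2 ≤ 1 then f + l else 0) -
      (if 0 ≤ z.1 ∧ z.1 + z.2 ≤ 1 ∧ 0 ≤ l - m then l - m else 0) := by
    by_cases hk : 0 ≤ l - m
    · rw [min_eq_right (by linarith)]
      by_cases h : 0 ≤ z.1 ∧ z.1 + z.2 ≤ 1
      · have h2 := key2 h.1 hk
        rw [if_pos ⟨h.1, h2, h.2⟩, if_pos ⟨h.1, h2, h.2⟩, if_pos ⟨h.1, h.2, hk⟩]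
        ring
      · rw [if_neg (by tauto), if_neg (by tauto), if_neg (by tauto)]
        ring
    · rw [min_eq_left (by linarith), if_neg (by tauto : ¬(0 ≤ z.1 ∧ z.1 + z.2 ≤ 1 ∧ 0 ≤ l - m))]
      ring
  have h2 : (if 0 ≤ z.1 ∧ 0 ≤ z.2 ∧ 0 ≤ l ∧ 0 ≤ m then min l m else 0) =
      (if 0 ≤ z.1 ∧ 0 ≤ z.2 ∧ 0 ≤ l ∧ 0 ≤ m then l else 0) -
      (if 0 ≤ z.1 ∧ 0 ≤ m ∧ 0 ≤ l - m then l - m else 0) := by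
    by_cases hk : 0 ≤ l - m
    · rw [min_eq_right (by linarith)]
      by_cases h : 0 ≤ z.1 ∧ 0 ≤ m
      · have h2 := key2 h.1 hk
        have h3 : 0 ≤ l := by linarith
        rw [if_pos ⟨h.1, h2, h3, h.2⟩, if_pos ⟨h.1, h2, h3, h.2⟩, if_pos ⟨h.1, h.2, hk⟩]
        ring
      · rw [if_neg (by tauto), if_neg (by tauto), if_neg (by tauto)]
        ring
    · rw [min_eq_left (by linarith), if_neg (by tauto : ¬(0 ≤ z.1 ∧ 0 ≤ m ∧ 0 ≤ l - m))]
      ring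
  have h3 : (if 0 ≤ z.1 ∧ 0 ≤ z.2 ∧ 0 ≤ l ∧ 0 ≤ m then l else 0) =
      (if 0 ≤ z.2 ∧ 0 ≤ l ∧ 0 ≤ σ then l else 0) + (if 0 ≤ z.1 ∧ 0 ≤ m ∧ σ ≤ 0 then l else 0) := by
    rcases lt_or_gt_of_ne hz with h | h
    · have e : (0 ≤ z.1 ∧ 0 ≤ z.2 ∧ 0 ≤ l ∧ 0 ≤ m) ↔ (0 ≤ z.1 ∧ 0 ≤ m ∧ σ ≤ 0) :=
        ⟨fun h' => ⟨h'.1, h'.2.2.2, h.le⟩,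
          fun h' => ⟨h'.1, key4 h'.1 h'.2.2, key6 h'.2.1 h'.2.2, h'.2.1⟩⟩
      rw [if_congr e rfl rfl, if_neg (fun h' : 0 ≤ z.2 ∧ 0 ≤ l ∧ 0 ≤ σ => absurd h'.2.2 (not_le.2 h)),
        zero_add]
    · have e : (0 ≤ z.1 ∧ 0 ≤ z.2 ∧ 0 ≤ l ∧ 0 ≤ m) ↔ (0 ≤ z.2 ∧ 0 ≤ l ∧ 0 ≤ σ) :=
        ⟨fun h' => ⟨h'.2.1, h'.2.2.1, h.le⟩,
          fun h' => ⟨key3 h'.1 h'.2.2, h'.1, h'.2.1, key5 h'.2.1 h'.2.2⟩⟩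
      rw [if_congr e rfl rfl, if_neg (fun h' : 0 ≤ z.1 ∧ 0 ≤ m ∧ σ ≤ 0 => absurd h'.2.2 (not_le.2 h)),
        add_zero]
  rw [h1, h2, h3]
  ring

theorem nonneg_iff_of_mul {x y k : ℝ} (hk : 0 < k) (h : y = k * x) : 0 ≤ y ↔ 0 ≤ x := by
  rw [h]
  exact mul_nonneg_iff_of_pos_left hk

theorem integral_model (hA : 0 < A) (hAB : A ≤ B) (hG : G ≤ 0) (hN : 0 < A * B - G ^ 2) :
    Integrable (modelLocal A B G) ∧
    ∫ z, modelLocal A B G z =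
      (2 * A + 2 * B - 2 * G - A * B * (A + B - 2 * G) / (A * B - G ^ 2)) / 24 := by
  have hB : 0 < B := hA.trans_le hAB
  have hAG : 0 < A - G := by linarith
  have hBG : 0 < B - G := by linarith
  have hC : 0 < A + B - 2 * G := by linarith
  have hu : 0 < B * (A - G) := by positivity
  have hv : 0 < A * (B - G) := by positivity
  have hNne := hN.ne'
  have hAne := hA.ne'
  have hBne := hB.ne'
  have hAGne := hAG.ne'
  have hBGne := hBG.ne'
  have hCne := hC.ne'
  set N := A * B - G ^ 2 with hNdef
  -- `(0, e)` is where the bisector of `p q` meets the side `r q`, and `(ca, cb)` is the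
  -- circumcenter.
  set e : ℝ := (B - A) / (2 * (B - G)) with he
  set ca : ℝ := B * (A - G) / (2 * N) with hca
  set cb : ℝ := A * (B - G) / (2 * N) with hcb
  have hca0 : 0 < ca := by positivity
  have hcb0 : 0 < cb := by positivity
  -- the triangle beyond the bisector of `p q`
  obtain ⟨m1, i1, v1⟩ := integral_triangle (X := (0, e)) (Y := (1 / 2, 1 / 2)) (Z := (0, 1))
    (D := (A + B - 2 * G) / (4 * (B - G))) (by simp only [he]; field_simp; ring) (by positivity)
    (s := fun z => 2 * z.1)
    (t := fun z => (excessLeft A G z - excessRight B G z) / (A + B - 2 * G))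
    (fun z => by simp only; ring)
    (fun z => by simp only [he, excessLeft, excessRight]; field_simp; ring)
    (T := {z | 0 ≤ z.1 ∧ z.1 + z.2 ≤ 1 ∧ 0 ≤ excessLeft A G z - excessRight B G z})
    (fun z => by
      have h1 : 0 ≤ z.1 ↔ 0 ≤ 2 * z.1 := (nonneg_iff_of_mul two_pos rfl).symm
      have h2 : z.1 + z.2 ≤ 1 ↔ 2 * z.1 +
          (excessLeft A G z - excessRight B G z) / (A + B - 2 * G) ≤ 1 := by
        rw [← sub_nonneg, ← sub_nonneg (a := (1 : ℝ)) (b := 2 * z.1 + _)]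
        refine (nonneg_iff_of_mul (k := 2 * (B - G) / (A + B - 2 * G)) (by positivity) ?_).symm
        simp only [excessLeft, excessRight]; field_simp; ring
      have h3 : 0 ≤ excessLeft A G z - excessRight B G z ↔
          0 ≤ (excessLeft A G z - excessRight B G z) / (A + B - 2 * G) :=
        (nonneg_iff_of_mul (k := (A + B - 2 * G)⁻¹) (by positivity) (by field_simp)).symm
      rw [Set.mem_ofPred_eq, h1, h2, h3]
      tauto) (A - B) (-2 * (A - G)) (2 * (B - G))
  -- the two parts of the region nearest to `r`
  obtain ⟨m2, i2, v2⟩ := integral_triangle (X := (0, 0)) (Y := (1 / 2, 0)) (Z := (ca, cb))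
    (D := cb / 2) (by simp only; ring) (by positivity)
    (s := fun z => 2 * (z.1 * (A * (B - G)) - z.2 * (B * (A - G))) / (A * (B - G)))
    (t := fun z => z.2 / cb)
    (fun z => by simp only [hca, hcb]; field_simp; ring)
    (fun z => by simp only [hcb]; field_simp; ring)
    (T := {z | 0 ≤ z.2 ∧ 0 ≤ excessLeft A G z ∧
        0 ≤ z.1 * (A * (B - G)) - z.2 * (B * (A - G))})
    (fun z => by
      have h1 : 0 ≤ z.2 ↔ 0 ≤ z.2 / cb :=
        (nonneg_iff_of_mul (k := cb⁻¹) (by positivity) (by field_simp)).symm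
      have h2 : 0 ≤ excessLeft A G z ↔
          2 * (z.1 * (A * (B - G)) - z.2 * (B * (A - G))) / (A * (B - G)) + z.2 / cb ≤ 1 := by
        rw [← sub_nonneg (a := (1 : ℝ))]
        refine (nonneg_iff_of_mul (k := A⁻¹) (by positivity) ?_).symm
        simp only [excessLeft, hcb, hNdef]; field_simp; ring
      have h3 : 0 ≤ z.1 * (A * (B - G)) - z.2 * (B * (A - G)) ↔
          0 ≤ 2 * (z.1 * (A * (B - G)) - z.2 * (B * (A - G))) / (A * (B - G)) :=
        (nonneg_iff_of_mul (k := 2 / (A * (B - G))) (by positivity) (by field_simp)).symm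
      rw [Set.mem_ofPred_eq, h1, h2, h3]
      tauto) A (-2 * A) (-2 * G)
  obtain ⟨m3, i3, v3⟩ := integral_triangle (X := (0, 0)) (Y := (0, 1 / 2)) (Z := (ca, cb))
    (D := -(ca / 2)) (by simp only; ring) (by simp only [ne_eq, neg_eq_zero]; positivity)
    (s := fun z => -(2 * (z.1 * (A * (B - G)) - z.2 * (B * (A - G)))) / (B * (A - G)))
    (t := fun z => z.1 / ca)
    (fun z => by simp only [hca]; field_simp; ring)
    (fun z => by simp only [hca, hcb]; field_simp; ring)
    (T := {z | 0 ≤ z.1 ∧ 0 ≤ excessRight B G z ∧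
        z.1 * (A * (B - G)) - z.2 * (B * (A - G)) ≤ 0})
    (fun z => by
      have h1 : 0 ≤ z.1 ↔ 0 ≤ z.1 / ca :=
        (nonneg_iff_of_mul (k := ca⁻¹) (by positivity) (by field_simp)).symm
      have h2 : 0 ≤ excessRight B G z ↔
          -(2 * (z.1 * (A * (B - G)) - z.2 * (B * (A - G)))) / (B * (A - G)) + z.1 / ca ≤ 1 := by
        rw [← sub_nonneg (a := (1 : ℝ))]
        refine (nonneg_iff_of_mul (k := B⁻¹) (by positivity) ?_).symm
        simp only [excessRight, hca, hNdef]; field_simp; ring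
      have h3 : z.1 * (A * (B - G)) - z.2 * (B * (A - G)) ≤ 0 ↔
          0 ≤ -(2 * (z.1 * (A * (B - G)) - z.2 * (B * (A - G)))) / (B * (A - G)) := by
        rw [← neg_nonneg]
        exact (nonneg_iff_of_mul (k := 2 / (B * (A - G))) (by positivity) (by field_simp)).symm
      rw [Set.mem_ofPred_eq, h1, h2, h3]
      tauto) A (-2 * A) (-2 * G)
  -- The part of the region nearest to `r` in which `q` is at least as near as `p`.
  obtain ⟨m4, i4, v4⟩ := integral_triangle (X := (0, e)) (Y := (0, 1 / 2)) (Z := (ca, cb))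
    (D := -(ca * ((A - G) / (2 * (B - G))))) (by simp only [he]; field_simp; ring)
    (by simp only [ne_eq, neg_eq_zero]; positivity)
    (s := fun z => (excessLeft A G z - excessRight B G z) / (A - G))
    (t := fun z => z.1 / ca)
    (fun z => by simp only [hca]; field_simp; ring)
    (fun z => by
      simp only [he, hca, hcb, excessLeft, excessRight]; field_simp; simp only [hNdef]; ring)
    (T := {z | 0 ≤ z.1 ∧ 0 ≤ excessRight B G z ∧
        0 ≤ excessLeft A G z - excessRight B G z})
    (fun z => by
      have h1 : 0 ≤ z.1 ↔ 0 ≤ z.1 / ca :=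
        (nonneg_iff_of_mul (k := ca⁻¹) (by positivity) (by field_simp)).symm
      have h2 : 0 ≤ excessRight B G z ↔
          (excessLeft A G z - excessRight B G z) / (A - G) + z.1 / ca ≤ 1 := by
        rw [← sub_nonneg (a := (1 : ℝ))]
        refine (nonneg_iff_of_mul (k := (B - G) / (B * (A - G))) (by positivity) ?_).symm
        simp only [excessLeft, excessRight, hca, hNdef]; field_simp; ring
      have h3 : 0 ≤ excessLeft A G z - excessRight B G z ↔
          0 ≤ (excessLeft A G z - excessRight B G z) / (A - G) :=
        (nonneg_iff_of_mul (k := (A - G)⁻¹) (by positivity) (by field_simp)).symm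
      rw [Set.mem_ofPred_eq, h1, h2, h3]
      tauto) (A - B) (-2 * (A - G)) (2 * (B - G))
  have ek : (fun z : ℝ × ℝ => (A - B) + -2 * (A - G) * z.1 + 2 * (B - G) * z.2) =
      fun z => excessLeft A G z - excessRight B G z := by
    funext z
    simp only [excessLeft, excessRight]
    ring
  have el : (fun z : ℝ × ℝ => A + -2 * A * z.1 + -2 * G * z.2) = excessLeft A G := by
    funext z
    simp only [excessLeft]
    ring
  rw [ek] at i1 v1 i4 v4
  rw [el] at i2 v2 i3 v3
  have m0 : MeasurableSet stdTriangle := isClosed_stdTriangle.measurableSet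
  have hc0 : Continuous fun z : ℝ × ℝ => gramForm A B G z + excessLeft A G z := by
    simp only [gramForm, excessLeft]
    fun_prop
  have i0 : IntegrableOn (fun z : ℝ × ℝ => gramForm A B G z + excessLeft A G z) stdTriangle :=
    hc0.continuousOn.integrableOn_compact isCompact_stdTriangle
  have v0 : ∫ z in stdTriangle, (gramForm A B G z + excessLeft A G z) =
      A / 4 - G / 4 + B / 12 := by
    have := integral_stdTriangle A (-2 * A) (-2 * G) A (2 * G) B
    have e0 : (fun z : ℝ × ℝ => gramForm A B G z + excessLeft A G z) = fun z =>
        A + -2 * A * z.1 + -2 * G * z.2 + A * z.1 ^ 2 + 2 * G * (z.1 * z.2) + B * z.2 ^ 2 := by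
      funext z
      simp only [gramForm, excessLeft]
      ring
    rw [e0, this]
    ring
  have hae := measure_eq_zero_iff_ae_notMem.1
    (volume_line_through_zero (u := B * (A - G)) (v := A * (B - G)) hv.ne')
  have hcongr := hae.mono fun z hz => model_identity hA hAB hG hz
  have j0 := (integrable_indicator_iff m0).2 i0
  have j1 := (integrable_indicator_iff m1).2 i1
  have j2 := (integrable_indicator_iff m2).2 i2
  have j3 := (integrable_indicator_iff m3).2 i3
  have j4 := (integrable_indicator_iff m4).2 i4
  refine ⟨((((j0.sub j1).sub j2).sub j3).add j4).congr (hcongr.mono fun z hz => hz.symm), ?_⟩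
  refine (integral_congr_ae hcongr).trans
    ((integral_add' (((j0.sub j1).sub j2).sub j3) j4).trans ?_)
  rw [integral_sub' ((j0.sub j1).sub j2) j3, integral_sub' (j0.sub j1) j2, integral_sub' j0 j1,
    integral_indicator m0, integral_indicator m1, integral_indicator m2, integral_indicator m3,
    integral_indicator m4, v0, v1, v2, v3, v4]
  rw [abs_neg, abs_neg, abs_of_pos (by positivity), abs_of_pos (by positivity),
    abs_of_pos (by positivity), abs_of_pos (by positivity)]
  simp only [he, hca, hcb]
  field_simp
  rw [hNdef]
  ring

end

/-! ### From affine coordinates back to triangles in the plane -/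

open scoped NNReal

namespace Bary

variable {p q r : Plane} {a b c : Plane →ᵃ[ℝ] ℝ} {Δ : Finset Plane}

theorem sub_eq (h : Bary p q r a b c) (x : Plane) :
    x - r = a x • (p - r) + b x • (q - r) := by
  have h1 := h.comb x
  have h2 : c x = 1 - a x - b x := by linarith [h.sum x]
  rw [h2] at h1
  conv_lhs => rw [← h1]
  module

theorem dist_sq_r (h : Bary p q r a b c) (x : Plane) :
    dist r x ^ 2 = gramForm (‖p - r‖ ^ 2) (‖q - r‖ ^ 2) (inner ℝ (p - r) (q - r)) (a x, b x) := by
  rw [dist_comm, dist_eq_norm, h.sub_eq x, norm_add_sq_real, norm_smul, norm_smul,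
    inner_smul_left, inner_smul_right, mul_pow, mul_pow, Real.norm_eq_abs, Real.norm_eq_abs,
    sq_abs, sq_abs]
  simp only [gramForm, conj_trivial]
  ring

theorem dist_sq_p (h : Bary p q r a b c) (x : Plane) :
    dist p x ^ 2 = gramForm (‖p - r‖ ^ 2) (‖q - r‖ ^ 2) (inner ℝ (p - r) (q - r)) (a x, b x) +
      excessLeft (‖p - r‖ ^ 2) (inner ℝ (p - r) (q - r)) (a x, b x) := by
  rw [← h.dist_sq_r x, dist_comm r x, dist_eq_norm, dist_eq_norm,
    show p - x = (p - r) - (x - r) by abel, norm_sub_sq_real]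
  have : inner ℝ (p - r) (x - r) = a x * ‖p - r‖ ^ 2 + b x * inner ℝ (p - r) (q - r) := by
    rw [h.sub_eq x, inner_add_right, inner_smul_right, inner_smul_right, real_inner_self_eq_norm_sq]
  rw [this]
  simp only [excessLeft]
  ring

theorem dist_sq_q (h : Bary p q r a b c) (x : Plane) :
    dist q x ^ 2 = gramForm (‖p - r‖ ^ 2) (‖q - r‖ ^ 2) (inner ℝ (p - r) (q - r)) (a x, b x) +
      excessRight (‖q - r‖ ^ 2) (inner ℝ (p - r) (q - r)) (a x, b x) := by
  rw [← h.dist_sq_r x, dist_comm r x, dist_eq_norm, dist_eq_norm,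
    show q - x = (q - r) - (x - r) by abel, norm_sub_sq_real]
  have : inner ℝ (q - r) (x - r) = a x * inner ℝ (p - r) (q - r) + b x * ‖q - r‖ ^ 2 := by
    rw [h.sub_eq x, inner_add_right, inner_smul_right, inner_smul_right, real_inner_self_eq_norm_sq,
      real_inner_comm]
  rw [this]
  simp only [excessRight]
  ring

theorem norm_pos (h : Bary p q r a b c) : 0 < ‖p - r‖ ^ 2 ∧ 0 < ‖q - r‖ ^ 2 := by
  obtain ⟨-, hqr, hpr⟩ := h.vertices_ne
  exact ⟨pow_pos (norm_pos_iff.2 (sub_ne_zero.2 hpr)) 2,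
    pow_pos (norm_pos_iff.2 (sub_ne_zero.2 hqr)) 2⟩

theorem gram_pos (h : Bary p q r a b c) :
    0 < ‖p - r‖ ^ 2 * ‖q - r‖ ^ 2 - (inner ℝ (p - r) (q - r)) ^ 2 := by
  set B := ‖q - r‖ ^ 2 with hB
  set G : ℝ := inner ℝ (p - r) (q - r) with hG
  have hB0 : 0 < B := h.norm_pos.2
  -- With coordinates `(B, -G)` the squared distance from `y` to `r` is `B` times the Gram
  -- determinant.
  set y : Plane := B • p + (-G) • q + (1 - B + G) • r with hy
  have ha : a y = B := by
    rw [hy, affine_comb₃ _ _ _ _ _ _ _ (by ring), h.ap, h.aq, h.ar]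
    ring
  have hb : b y = -G := by
    rw [hy, affine_comb₃ _ _ _ _ _ _ _ (by ring), h.bp, h.bq, h.br]
    ring
  have hyr : y ≠ r := by
    intro e
    rw [e, h.ar] at ha
    linarith
  have h1 : 0 < dist r y ^ 2 := pow_pos (dist_pos.2 hyr.symm) 2
  rw [h.dist_sq_r y, ha, hb, ← hB, ← hG] at h1
  simp only [gramForm] at h1
  have h2 : 0 < B * (‖p - r‖ ^ 2 * B - G ^ 2) := by linarith
  exact pos_of_mul_pos_right h2 hB0.le

/-- A vertex with an angle of at most `π / 2` is never a hidden nearest vertex. -/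
theorem local_eq_zero (h : Bary p q r a b c) (hΔ : (Δ : Set Plane) = {p, q, r}) {x : Plane}
    (ha : 0 ≤ a x) (hb : 0 ≤ b x) (hc : c x < 0) (hG : 0 ≤ inner ℝ (p - r) (q - r)) :
    localTriangle Δ x = 0 := by
  unfold localTriangle
  rw [h.visible_eq_of_hidden hΔ ha hb hc, infDist_pair, infDist_triple hΔ, min_eq_left, sub_self]
  -- If `r` were strictly nearest, then `a x` and `b x` would both be below `1 / 2` because the
  -- inner product is nonnegative, forcing `c x` to be positive.
  by_contra! hlt
  have h1 := pow_lt_pow_left₀ (hlt.trans_le (min_le_left _ _)) dist_nonneg two_ne_zero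
  have h2 := pow_lt_pow_left₀ (hlt.trans_le (min_le_right _ _)) dist_nonneg two_ne_zero
  rw [h.dist_sq_p x, h.dist_sq_r x] at h1
  rw [h.dist_sq_q x, h.dist_sq_r x] at h2
  obtain ⟨hA, hB⟩ := h.norm_pos
  simp only [excessLeft, excessRight] at h1 h2
  have i1 := mul_nonneg hG hb
  have i2 := mul_nonneg hG ha
  have h3 : a x < 1 / 2 := by
    by_contra! h'
    have := mul_le_mul_of_nonneg_left h' hA.le
    linarith
  have h4 : b x < 1 / 2 := by
    by_contra! h'
    have := mul_le_mul_of_nonneg_left h' hB.le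
    linarith
  linarith [h.sum x]

theorem local_eq_zero_of_two_neg (h : Bary p q r a b c) (hΔ : (Δ : Set Plane) = {p, q, r})
    {x : Plane} (ha : a x < 0) (hb : b x < 0) : localTriangle Δ x = 0 := by
  unfold localTriangle
  rw [h.visible_eq_of_two_neg hΔ ha hb, sub_self]

/-- Used to see that a non-acute angle at one vertex makes the other two angles acute. -/
theorem inner_sub_sub_eq (A B C : Plane) :
    inner ℝ (B - A) (C - A) = ‖A - C‖ ^ 2 - inner ℝ (A - C) (B - C) := by
  rw [show B - A = (B - C) - (A - C) by abel, show C - A = -(A - C) by abel, inner_neg_right,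
    inner_sub_left, real_inner_self_eq_norm_sq, real_inner_comm]
  ring

theorem min_sq (s t : ℝ) (hs : 0 ≤ s) (ht : 0 ≤ t) : (min s t) ^ 2 = min (s ^ 2) (t ^ 2) := by
  rcases le_total s t with h | h
  · rw [min_eq_left h, min_eq_left (pow_le_pow_left₀ hs h 2)]
  · rw [min_eq_right h, min_eq_right (pow_le_pow_left₀ ht h 2)]

/-- The local Voronoi functional of a triangle that is not acute, in affine coordinates. -/
theorem local_eq_model (h : Bary p q r a b c) (hΔ : (Δ : Set Plane) = {p, q, r})
    (hG : inner ℝ (p - r) (q - r) ≤ 0) (x : Plane) :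
    localTriangle Δ x =
      modelLocal (‖p - r‖ ^ 2) (‖q - r‖ ^ 2) (inner ℝ (p - r) (q - r)) (a x, b x) := by
  have hr := h.dist_sq_r x
  have hp := h.dist_sq_p x
  have hq := h.dist_sq_q x
  obtain ⟨hA, hB⟩ := h.norm_pos
  have hs := h.sum x
  have hmin2 : (min (dist p x) (dist q x)) ^ 2 = dist r x ^ 2 +
      min (excessLeft (‖p - r‖ ^ 2) (inner ℝ (p - r) (q - r)) (a x, b x))
        (excessRight (‖q - r‖ ^ 2) (inner ℝ (p - r) (q - r)) (a x, b x)) := by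
    rw [min_sq _ _ dist_nonneg dist_nonneg, hp, hq, hr, min_add_add_left]
  have hmin3 : (min (min (dist p x) (dist q x)) (dist r x)) ^ 2 = dist r x ^ 2 +
      min (min (excessLeft (‖p - r‖ ^ 2) (inner ℝ (p - r) (q - r)) (a x, b x))
        (excessRight (‖q - r‖ ^ 2) (inner ℝ (p - r) (q - r)) (a x, b x))) 0 := by
    rw [min_sq _ _ (le_min dist_nonneg dist_nonneg) dist_nonneg, hmin2]
    simpa using min_add_add_left (dist r x ^ 2)
      (min (excessLeft (‖p - r‖ ^ 2) (inner ℝ (p - r) (q - r)) (a x, b x))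
        (excessRight (‖q - r‖ ^ 2) (inner ℝ (p - r) (q - r)) (a x, b x))) 0
  have hnear : 0 ≤ a x → 0 ≤ b x →
      (nearRegion (‖p - r‖ ^ 2) (‖q - r‖ ^ 2) (inner ℝ (p - r) (q - r))).indicator
        (fun z => min (excessLeft (‖p - r‖ ^ 2) (inner ℝ (p - r) (q - r)) z)
          (excessRight (‖q - r‖ ^ 2) (inner ℝ (p - r) (q - r)) z)) (a x, b x) =
      min (excessLeft (‖p - r‖ ^ 2) (inner ℝ (p - r) (q - r)) (a x, b x))
        (excessRight (‖q - r‖ ^ 2) (inner ℝ (p - r) (q - r)) (a x, b x)) -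
      min (min (excessLeft (‖p - r‖ ^ 2) (inner ℝ (p - r) (q - r)) (a x, b x))
        (excessRight (‖q - r‖ ^ 2) (inner ℝ (p - r) (q - r)) (a x, b x))) 0 := by
    intro ha hb
    by_cases hm : 0 ≤ min (excessLeft (‖p - r‖ ^ 2) (inner ℝ (p - r) (q - r)) (a x, b x))
        (excessRight (‖q - r‖ ^ 2) (inner ℝ (p - r) (q - r)) (a x, b x))
    · rw [Set.indicator_of_mem, min_eq_right hm, sub_zero]
      exact ⟨ha, hb, (le_min_iff.1 hm).1, (le_min_iff.1 hm).2⟩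
    · rw [Set.indicator_of_notMem, min_eq_left (not_le.1 hm).le, sub_self]
      rintro ⟨-, -, h1, h2⟩
      exact hm (le_min h1 h2)
  by_cases hx : x ∈ convexHull ℝ (Δ : Set Plane)
  · obtain ⟨ha, hb, hc⟩ := (h.mem_hull_iff hΔ x).1 hx
    rw [localTriangle_of_mem_hull hx, infDist_triple hΔ, hmin3, modelLocal, Set.indicator_of_mem,
      hnear ha hb, ← hr]
    · ring
    · exact ⟨ha, hb, by simp only; linarith⟩
  · have hx' := hx
    rw [h.mem_hull_iff hΔ] at hx'
    rw [modelLocal, Set.indicator_of_notMem (s := stdTriangle)]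
    · by_cases hab : 0 ≤ a x ∧ 0 ≤ b x
      · obtain ⟨ha, hb⟩ := hab
        have hc : c x < 0 := by
          by_contra! hc
          exact hx' ⟨ha, hb, hc⟩
        rw [hnear ha hb]
        unfold localTriangle
        rw [h.visible_eq_of_hidden hΔ ha hb hc, infDist_pair, infDist_triple hΔ, hmin2, hmin3]
        ring
      · rw [Set.indicator_of_notMem fun h' => hab ⟨h'.1, h'.2.1⟩, sub_self]
        -- Outside the triangle and the cone at `r`, either every vertex is visible or the hidden
        -- vertex has an acute angle, so the local functional vanishes.
        have hset1 := set_rotate hΔ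
        have hset2 := set_rotate hset1
        by_cases ha : a x < 0
        · by_cases hb : b x < 0
          · exact h.local_eq_zero_of_two_neg hΔ ha hb
          · by_cases hc : c x < 0
            · exact h.rotate.rotate.local_eq_zero_of_two_neg hset2 hc ha
            · refine h.rotate.local_eq_zero hset1 (not_lt.1 hb) (not_lt.1 hc) ha ?_
              rw [inner_sub_sub_eq]
              linarith
        · have hb : b x < 0 := by
            by_contra! hb
            exact hab ⟨not_lt.1 ha, hb⟩
          by_cases hc : c x < 0
          · exact h.rotate.local_eq_zero_of_two_neg hset1 hb hc
          · refine h.rotate.rotate.local_eq_zero hset2 (not_lt.1 hc) (not_lt.1 ha) hb ?_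
            rw [real_inner_comm, inner_sub_sub_eq, real_inner_comm]
            linarith
    · rintro ⟨ha, hb, hc⟩
      exact hx' ⟨ha, hb, by simp only at hc; linarith⟩

/-- The parametrization of the plane by the first two barycentric coordinates. -/
def coordEquiv (h : Bary p q r a b c) : (ℝ × ℝ) ≃ₗ[ℝ] Plane where
  toFun z := z.1 • (p - r) + z.2 • (q - r)
  map_add' z w := by simp only [Prod.fst_add, Prod.snd_add]; module
  map_smul' k z := by simp only [Prod.smul_fst, Prod.smul_snd, RingHom.id_apply, smul_eq_mul]; module
  invFun y := (a.linear y, b.linear y)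
  left_inv z := by
    have h1 : ∀ l : Plane →ᵃ[ℝ] ℝ, ∀ y w : Plane, l.linear (y - w) = l y - l w := fun l y w =>
      l.linearMap_vsub y w
    ext
    · simp [h1, h.ap, h.aq, h.ar]
    · simp [h1, h.bp, h.bq, h.br]
  right_inv y := by
    have h1 := h.sub_eq (y + r)
    have h2 : ∀ l : Plane →ᵃ[ℝ] ℝ, l (y + r) = l.linear y + l r := fun l => l.map_vadd r y
    rw [h2, h2, h.ar, h.br] at h1
    simpa using h1.symm

theorem coordEquiv_apply (h : Bary p q r a b c) (z : ℝ × ℝ) :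
    a (r + h.coordEquiv z) = z.1 ∧ b (r + h.coordEquiv z) = z.2 := by
  have h1 := h.coordEquiv.symm_apply_apply z
  have h2 : ∀ l : Plane →ᵃ[ℝ] ℝ, l (r + h.coordEquiv z) = l.linear (h.coordEquiv z) + l r := by
    intro l
    rw [add_comm]
    exact l.map_vadd r _
  have e : h.coordEquiv.symm (h.coordEquiv z) =
    (a.linear (h.coordEquiv z), b.linear (h.coordEquiv z)) := rfl
  rw [e, Prod.ext_iff] at h1
  rw [h2, h2, h.ar, h.br, add_zero, add_zero]
  exact h1

/-- Integration in barycentric coordinates, up to a constant. -/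
theorem exists_integral_eq (h : Bary p q r a b c) :
    ∃ κ : ℝ≥0, ∀ F : ℝ × ℝ → ℝ,
      (Integrable F → Integrable fun x : Plane => F (a x, b x)) ∧
      ∫ x : Plane, F (a x, b x) = κ * ∫ z, F z := by
  set L := h.coordEquiv.toContinuousLinearEquiv with hL
  have hLa : ∀ z, L z = h.coordEquiv z := fun z => rfl
  set M := L.toHomeomorph.toMeasurableEquiv with hM
  have hMa : ∀ z, M z = h.coordEquiv z := fun z => rfl
  have hmap : (Measure.map M volume : Measure Plane).IsAddHaarMeasure :=
    L.isAddHaarMeasure_map volume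
  set κ := Measure.addHaarScalarFactor (volume : Measure Plane) (Measure.map M volume)
  -- Uniqueness of Haar measure; the value of the constant is read off later from the area of the
  -- triangle.
  have hκ : (volume : Measure Plane) = κ • Measure.map M volume :=
    Measure.isAddLeftInvariant_eq_smul _ _
  refine ⟨κ, fun F => ?_⟩
  have hcomp : (fun y : Plane => F (a (r + y), b (r + y))) ∘ M = F := by
    funext z
    simp only [Function.comp, hMa, (h.coordEquiv_apply z).1, (h.coordEquiv_apply z).2]
  constructor
  · intro hF
    have h1 : Integrable (fun y : Plane => F (a (r + y), b (r + y))) := by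
      rw [hκ]
      apply Integrable.smul_measure_nnreal
      rw [integrable_map_equiv, hcomp]
      exact hF
    have h2 := h1.comp_add_left (-r)
    simpa using h2
  · rw [← integral_add_left_eq_self (fun x : Plane => F (a x, b x)) r]
    conv_lhs => rw [hκ]
    rw [integral_smul_nnreal_measure, integral_map_equiv, NNReal.smul_def, smul_eq_mul]
    congr 1
    exact congrArg (fun f => ∫ z, f z) hcomp

theorem circumradius_sq (h : Bary p q r a b c) (hΔ : (Δ : Set Plane) = {p, q, r})
    (hT : IsTriangle Δ) :
    4 * circumradius Δ ^ 2 = ‖p - r‖ ^ 2 * ‖q - r‖ ^ 2 *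
      (‖p - r‖ ^ 2 + ‖q - r‖ ^ 2 - 2 * inner ℝ (p - r) (q - r)) /
      (‖p - r‖ ^ 2 * ‖q - r‖ ^ 2 - (inner ℝ (p - r) (q - r)) ^ 2) := by
  have hN := h.gram_pos
  have hm : ∀ v, v ∈ Δ ↔ v = p ∨ v = q ∨ v = r := fun v => by
    rw [← Finset.mem_coe, hΔ]; simp
  have key : ∀ ρ ∈ {ρ : ℝ | ∃ o : Plane, ∀ v ∈ Δ, dist v o = ρ}, 0 ≤ ρ ∧
      4 * ρ ^ 2 = ‖p - r‖ ^ 2 * ‖q - r‖ ^ 2 *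
      (‖p - r‖ ^ 2 + ‖q - r‖ ^ 2 - 2 * inner ℝ (p - r) (q - r)) /
      (‖p - r‖ ^ 2 * ‖q - r‖ ^ 2 - (inner ℝ (p - r) (q - r)) ^ 2) := by
    rintro ρ ⟨o, ho⟩
    have hp := ho p ((hm p).2 (by simp))
    have hq := ho q ((hm q).2 (by simp))
    have hr := ho r ((hm r).2 (by simp))
    refine ⟨hr ▸ dist_nonneg, ?_⟩
    have ep := h.dist_sq_p o
    have eq := h.dist_sq_q o
    have er := h.dist_sq_r o
    rw [hp] at ep
    rw [hq] at eq
    rw [hr] at er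
    rw [eq_div_iff hN.ne']
    simp only [gramForm, excessLeft, excessRight] at ep eq er
    generalize ‖p - r‖ ^ 2 = A at *
    generalize ‖q - r‖ ^ 2 = B at *
    generalize (inner ℝ (p - r) (q - r) : ℝ) = G at *
    generalize a o = α at *
    generalize b o = β at *
    -- Equal distances to the three vertices form a linear system for the barycentric coordinates of
    -- the center, with the Gram determinant as determinant. So every admissible radius has the same
    -- square and the infimum is over a single number.
    have e1 : 2 * (A * α + G * β) = A := by linarith
    have e2 : 2 * (G * α + B * β) = B := by linarith
    have e3 : 2 * ρ ^ 2 = A * α + B * β := by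
      linear_combination 2 * er + α * e1 + β * e2
    have e4 : 2 * ((A * B - G ^ 2) * α) = B * (A - G) := by
      linear_combination B * e1 - G * e2
    have e5 : 2 * ((A * B - G ^ 2) * β) = A * (B - G) := by
      linear_combination A * e2 - G * e1
    linear_combination 2 * (A * B - G ^ 2) * e3 + A * e4 + B * e5
  obtain ⟨o, R, hR⟩ := hT.exists_circle
  have hset : {ρ : ℝ | ∃ o : Plane, ∀ v ∈ Δ, dist v o = ρ} = {R} := by
    apply Set.Subset.antisymm
    · intro ρ hρ
      have h1 := key ρ hρ
      have h2 := key R ⟨o, hR⟩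
      rw [Set.mem_singleton_iff, ← pow_left_inj₀ h1.1 h2.1 two_ne_zero]
      linarith [h1.2, h2.2]
    · rintro _ rfl
      exact ⟨o, hR⟩
  rw [circumradius, hset, csInf_singleton]
  exact (key R ⟨o, hR⟩).2

theorem sumSqEdges_eq (h : Bary p q r a b c) (hΔ : (Δ : Set Plane) = {p, q, r}) :
    sumSqEdges Δ = 2 * ‖p - r‖ ^ 2 + 2 * ‖q - r‖ ^ 2 - 2 * inner ℝ (p - r) (q - r) := by
  classical
  obtain ⟨hpq, hqr, hpr⟩ := h.vertices_ne
  have hΔ' : Δ = {p, q, r} := by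
    apply Finset.coe_injective
    simpa using hΔ
  have hsum : ∀ F : Plane → ℝ, ∑ v ∈ Δ, F v = F p + F q + F r := by
    intro F
    rw [hΔ', Finset.sum_insert (by simp [hpq, hpr]), Finset.sum_insert (by simp [hqr]),
      Finset.sum_singleton, add_assoc]
  have e1 : dist p q ^ 2 = ‖p - r‖ ^ 2 + ‖q - r‖ ^ 2 - 2 * inner ℝ (p - r) (q - r) := by
    rw [dist_eq_norm, show p - q = (p - r) - (q - r) by abel, norm_sub_sq_real]
    ring
  rw [sumSqEdges, hsum, hsum, hsum, hsum, dist_comm q p, dist_comm r p, dist_comm r q, e1,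
    dist_eq_norm p r, dist_eq_norm q r, dist_self, dist_self, dist_self]
  ring

end Bary

/-- For a triangle that is not acute, the Voronoi functional is the integral of the local one. -/
theorem Bary.integral_local {p q r : Plane} {a b c : Plane →ᵃ[ℝ] ℝ} {Δ : Finset Plane}
    (h : Bary p q r a b c) (hΔ : (Δ : Set Plane) = {p, q, r}) (hT : IsTriangle Δ)
    (hG : inner ℝ (p - r) (q - r) ≤ 0) (hle : ‖p - r‖ ^ 2 ≤ ‖q - r‖ ^ 2) :
    Integrable (localTriangle Δ) ∧
      ∫ x, localTriangle Δ x = area Δ / 12 * (sumSqEdges Δ - 4 * circumradius Δ ^ 2) := by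
  obtain ⟨hA, hB⟩ := h.norm_pos
  obtain ⟨i, v⟩ := integral_model hA hle hG h.gram_pos
  obtain ⟨κ, hκ⟩ := h.exists_integral_eq
  obtain ⟨h1, h2⟩ := hκ (modelLocal (‖p - r‖ ^ 2) (‖q - r‖ ^ 2) (inner ℝ (p - r) (q - r)))
  have he : localTriangle Δ = fun x => modelLocal (‖p - r‖ ^ 2) (‖q - r‖ ^ 2)
      (inner ℝ (p - r) (q - r)) (a x, b x) := funext fun x => h.local_eq_model hΔ hG x
  -- The unknown constant is found by integrating the indicator of the triangle.
  have harea : area Δ = κ / 2 := by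
    have h3 := (hκ (stdTriangle.indicator fun _ => 1)).2
    have e1 : (fun x : Plane => stdTriangle.indicator (fun _ => (1 : ℝ)) (a x, b x)) =
        (convexHull ℝ (Δ : Set Plane)).indicator fun _ => 1 := by
      funext x
      have hs := h.sum x
      by_cases hx : x ∈ convexHull ℝ (Δ : Set Plane)
      · rw [Set.indicator_of_mem hx, Set.indicator_of_mem]
        obtain ⟨ha, hb, hc⟩ := (h.mem_hull_iff hΔ x).1 hx
        exact ⟨ha, hb, by simp only; linarith⟩
      · rw [Set.indicator_of_notMem hx, Set.indicator_of_notMem]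
        rintro ⟨ha, hb, hc⟩
        exact hx ((h.mem_hull_iff hΔ x).2 ⟨ha, hb, by simp only at hc; linarith⟩)
    have e2 : ∫ z in stdTriangle, (1 : ℝ) = 1 / 2 := by
      have := integral_stdTriangle 1 0 0 0 0 0
      simpa using this
    rw [e1, integral_indicator isClosed_stdTriangle.measurableSet, e2,
      integral_indicator (Δ.finite_toSet.isCompact_convexHull ℝ).isClosed.measurableSet] at h3
    rw [setIntegral_const, smul_eq_mul, mul_one] at h3
    rw [area, h3]
    ring
  refine ⟨he ▸ h1 i, ?_⟩
  rw [he, h2, v, harea, h.circumradius_sq hΔ hT, h.sumSqEdges_eq hΔ]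
  ring

theorem angle_lt_iff {p q r : Plane} (hp : p ≠ q) (hr : r ≠ q) :
    EuclideanGeometry.angle p q r < Real.pi / 2 ↔ 0 < inner ℝ (p - q) (r - q) := by
  have h1 : 0 < ‖p - q‖ * ‖r - q‖ :=
    mul_pos (norm_pos_iff.2 (sub_ne_zero.2 hp)) (norm_pos_iff.2 (sub_ne_zero.2 hr))
  rw [EuclideanGeometry.angle, InnerProductGeometry.angle, Real.arccos_lt_pi_div_two,
    vsub_eq_sub, vsub_eq_sub, div_pos_iff_of_pos_right h1]

/-- Outside the triangle either two coordinates are negative and every vertex is visible, or one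
vertex is hidden but, its angle being acute, is not the only nearest one. -/
theorem IsTriangle.local_eq_zero_of_acute {Δ : Finset Plane} (hT : IsTriangle Δ) (hac : IsAcute Δ)
    {x : Plane} (hx : x ∉ convexHull ℝ (Δ : Set Plane)) : localTriangle Δ x = 0 := by
  have key : ∀ {p q r a b c}, Bary p q r a b c → (Δ : Set Plane) = {p, q, r} →
      0 ≤ inner ℝ (p - r) (q - r) := by
    intro p q r a b c h hΔ
    have hm : ∀ v, v ∈ Δ ↔ v = p ∨ v = q ∨ v = r := fun v => by
      rw [← Finset.mem_coe, hΔ]; simp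
    obtain ⟨hpq, hqr, hpr⟩ := h.vertices_ne
    exact ((angle_lt_iff hpr hqr).1 (hac p ((hm p).2 (by simp)) r ((hm r).2 (by simp)) q
      ((hm q).2 (by simp)) hpr hqr.symm hpq)).le
  obtain ⟨r, hr⟩ := hT.nonempty
  obtain ⟨p, q, a, b, c, h, hΔ⟩ := hT.exists_bary hr
  have hset1 := Bary.set_rotate hΔ
  have hset2 := Bary.set_rotate hset1
  rw [h.mem_hull_iff hΔ] at hx
  by_cases ha : a x < 0
  · by_cases hb : b x < 0
    · exact h.local_eq_zero_of_two_neg hΔ ha hb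
    · by_cases hc : c x < 0
      · exact h.rotate.rotate.local_eq_zero_of_two_neg hset2 hc ha
      · exact h.rotate.local_eq_zero hset1 (not_lt.1 hb) (not_lt.1 hc) ha (key h.rotate hset1)
  · by_cases hb : b x < 0
    · by_cases hc : c x < 0
      · exact h.rotate.local_eq_zero_of_two_neg hset1 hb hc
      · exact h.rotate.rotate.local_eq_zero hset2 (not_lt.1 hc) (not_lt.1 ha) hb
          (key h.rotate.rotate hset2)
    · refine h.local_eq_zero hΔ (not_lt.1 ha) (not_lt.1 hb) ?_ (key h hΔ)
      by_contra! hc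
      exact hx ⟨not_lt.1 ha, not_lt.1 hb, hc⟩

/-- The Voronoi functional of a triangle is the integral of its local Voronoi functional. -/
theorem IsTriangle.integral_local {Δ : Finset Plane} (hT : IsTriangle Δ) :
    Integrable (localTriangle Δ) ∧ ∫ x, localTriangle Δ x = triangleVoronoi Δ := by
  by_cases hac : IsAcute Δ
  · have hc := Δ.finite_toSet.isCompact_convexHull ℝ
    have he : localTriangle Δ = (convexHull ℝ (Δ : Set Plane)).indicator
        fun x => Metric.infDist x (Δ : Set Plane) ^ 2 := by
      funext x
      by_cases hx : x ∈ convexHull ℝ (Δ : Set Plane)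
      · rw [Set.indicator_of_mem hx, localTriangle_of_mem_hull hx]
      · rw [Set.indicator_of_notMem hx, hT.local_eq_zero_of_acute hac hx]
    have hcont : Continuous fun x : Plane => Metric.infDist x (Δ : Set Plane) ^ 2 :=
      (Metric.continuous_infDist_pt _).pow 2
    rw [he, triangleVoronoi, if_pos hac]
    exact ⟨(integrable_indicator_iff hc.isClosed.measurableSet).2
      (hcont.continuousOn.integrableOn_compact hc), integral_indicator hc.isClosed.measurableSet⟩
  · rw [triangleVoronoi, if_neg hac]
    unfold IsAcute at hac
    push Not at hac
    obtain ⟨p', hp, r, hr, q', hq, hpr, hrq, hpq, hang⟩ := hac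
    rw [← not_lt, angle_lt_iff hpr hrq.symm, not_lt] at hang
    obtain ⟨p, q, a, b, c, h, hΔ⟩ := hT.exists_bary hr
    have hG : inner ℝ (p - r) (q - r) ≤ 0 := by
      rw [← Finset.mem_coe, hΔ] at hp hq
      simp only [Set.mem_insert_iff, Set.mem_singleton_iff, hpr, hrq.symm, or_false] at hp hq
      rcases hp with rfl | rfl <;> rcases hq with rfl | rfl
      · exact absurd rfl hpq
      · exact hang
      · rwa [real_inner_comm]
      · exact absurd rfl hpq
    rcases le_total (‖p - r‖ ^ 2) (‖q - r‖ ^ 2) with hle | hle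
    · exact h.integral_local hΔ hT hG hle
    · exact h.swap.integral_local (Bary.set_swap hΔ) hT (by rwa [real_inner_comm]) hle

/-! ### Integration of the pointwise inequality -/

theorem integral_localVoronoi {F : Finset (Finset Plane)} (hF : ∀ T ∈ F, IsTriangle T) :
    Integrable (localVoronoi F) ∧ ∫ x, localVoronoi F x = voronoi F := by
  refine ⟨integrable_finsetSum F fun T hT => (hF T hT).integral_local.1, ?_⟩
  unfold localVoronoi voronoi
  rw [integral_finsetSum F fun T hT => (hF T hT).integral_local.1]
  exact Finset.sum_congr rfl fun T hT => (hF T hT).integral_local.2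

/-- Two distinct triangles of `K` meet in the hull of at most two common vertices, hence inside the
null set `lineUnion S`, so the pointwise inequality holds almost everywhere. -/
theorem voronoi_le {S : Finset Plane} (hS : GeneralPosition S)
    {K : Geometry.SimplicialComplex ℝ Plane} (hK : IsGeometricTriangulation S K) :
    voronoi (triangles S K) ≤ voronoi (delaunay S) := by
  classical
  obtain ⟨i1, v1⟩ := integral_localVoronoi fun T (hT : T ∈ triangles S K) =>
    isTriangle_of_mem_triangles hT
  obtain ⟨i2, v2⟩ := integral_localVoronoi fun T (hT : T ∈ delaunay S) => (mem_delaunay.1 hT).2.1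
  rw [← v1, ← v2]
  refine integral_mono_ae i1 i2 ?_
  filter_upwards [measure_eq_zero_iff_ae_notMem.1 (volume_lineUnion S)] with x hx
  refine localVoronoi_le hS hK fun T hT T' hT' hne h1 h2 => ?_
  exfalso
  apply hx
  obtain ⟨hTS, hT3, hTK⟩ := mem_triangles.1 hT
  obtain ⟨-, hT3', hTK'⟩ := mem_triangles.1 hT'
  have hI := K.inter_subset_convexHull hTK hTK' ⟨h1, h2⟩
  rw [← Finset.coe_inter] at hI
  refine hull_subset_lineUnion (t := T ∩ T') (Finset.inter_subset_left.trans hTS) ?_ ?_ hI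
  · have : ((T ∩ T' : Finset Plane) : Set Plane).Nonempty := convexHull_nonempty_iff.1 ⟨x, hI⟩
    exact Finset.coe_nonempty.1 this
  · by_contra! hcard
    have e1 := Finset.eq_of_subset_of_card_le (Finset.inter_subset_left (s₁ := T) (s₂ := T'))
      (by omega)
    have e2 := Finset.eq_of_subset_of_card_le (Finset.inter_subset_right (s₁ := T) (s₂ := T'))
      (by omega)
    exact hne (e1.symm.trans e2)

end VoronoiFunctional

end

open VoronoiFunctional in
theorem mainTheorem1 (S : Finset Plane) (hS : GeneralPosition S)
    (K : Geometry.SimplicialComplex ℝ Plane) (hK : IsGeometricTriangulation S K) :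
    voronoi (triangles S K) ≤ voronoi (delaunay S) ∧
    ∀ x : Plane,
      (∀ Δ ∈ triangles S K, ∀ Δ' ∈ triangles S K, Δ ≠ Δ' →
        x ∈ convexHull ℝ (Δ : Set Plane) → x ∈ convexHull ℝ (Δ' : Set Plane) → x ∈ S) →
      localVoronoi (triangles S K) x ≤ localVoronoi (delaunay S) x := by
  exact ⟨voronoi_le hS hK, fun x hx => localVoronoi_le hS hK hx⟩
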